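/- Let $d\ge 1$, $0<s<1$, $1\le q\le p<\infty$ and $\varepsilon>0$. There is a constant $C$ depending only on $d,s,p,q,\varepsilon$ such that the following holds. Let $\Omega\subset\mathbb R^d$ be an $\varepsilon$-uniform domain with an admissible Whitney covering $\mathcal W$, and let $f\in L^1_{\rm loc}(\Omega)$ be complex-valued. Put $$\|f\|_{\dot A^s_{p,q}(\Omega)}=\left(\int_\Omega\left(\int_\Omega\frac{|f(x)-f(y)|^q}{|x-y|^{sq+d}}\,dy\right)^{p/q}dx\right)^{1/p},\qquad N_{\mathcal W}(f)=\left(\sum_{Q\in\mathcal W}\int_Q\left(\int_{5Q\cap\Omega}\frac{|f(x)-f(y)|^q}{|x-y|^{sq+d}}\,dy\right)^{p/q}dx\right)^{1/p},$$ both with values in $[0,\infty]$ (if $5Q\subset\Omega$, as for the usual Whitney coverings, then $5Q\cap\Omega=5Q$). Then $$N_{\mathcal W}(f)\le C\,\|f\|_{\dot A^s_{p,q}(\Omega)}\quad\text{and}\quad \|f\|_{\dot A^s_{p,q}(\Omega)}\le C\,N_{\mathcal W}(f);$$ in particular one of the two is finite if and only if the other is. Here a domain is a nonempty connected open set, $\ell(Q)$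 is the side length of a cube $Q$, $tQ$ is the concentric open cube of side length $t\,\ell(Q)$, and $D(Q,S)=\ell(Q)+\operatorname{dist}(Q,S)+\ell(S)$. A Whitney covering of $\Omega$ is a family $\mathcal W$ of pairwise disjoint open dyadic cubes such that the union of their closures is $\Omega$; for some $c>0$ every $Q\in\mathcal W$ satisfies $c\,\ell(Q)\le\operatorname{dist}(Q,\partial\Omega)\le 4c\,\ell(Q)$; no point lies in more than $N$ of the cubes $50Q$, $Q\in\mathcal W$, for some $N\in\mathbb N$; and $\ell(S)\ge\frac12\ell(Q)$ whenever $Q,S\in\mathcal W$ and $S\subset 5Q$. The domain $\Omega$ is $\varepsilon$-uniform with admissible Whitney covering $\mathcal W$ if for all $Q,S\in\mathcal W$ there are $Q_1,\dots,Q_M\in\mathcal W$ with $Q_1=Q$, $Q_M=S$, $\overline{Q_j}\cap\overline{Q_{j+1}}\ne\emptyset$ for $j<M$, $\sum_{j=1}^M\ell(Q_j)\le\frac1\varepsilon D(Q,S)$, and some $1\le j_0\le M$ such that $\ell(Q_j)\ge\varepsilon D(Q,Q_j)$ for $j\le j_0$ and $\ell(Q_j)\ge\varepsilon D(Q_j,S)$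 for $j\ge j_0$. -/

import Mathlib

open MeasureTheory
open scoped NNReal ENNReal

noncomputable section

/-- A dyadic cube of `ℝ^d`: it has side length `2 ^ scale` and lower corner `2 ^ scale * index`. -/
structure DyadicCube (d : ℕ) where
  scale : ℤ
  index : Fin d → ℤ

namespace DyadicCube

variable {d : ℕ}

/-- The side length `ℓ(Q)`. -/
def side (Q : DyadicCube d) : ℝ := (2 : ℝ) ^ Q.scale

/-- The centre of the cube. -/
def center (Q : DyadicCube d) (i : Fin d) : ℝ := ((Q.index i : ℝ) + 1 / 2) * Q.side

/-- The open cube `Q` as a set of points. -/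
def toSet (Q : DyadicCube d) : Set (EuclideanSpace ℝ (Fin d)) :=
  {x | ∀ i, x i ∈ Set.Ioo ((Q.index i : ℝ) * Q.side) (((Q.index i : ℝ) + 1) * Q.side)}

/-- The open cube `tQ` with the same centre as `Q` and side length `t ℓ(Q)`. -/
def dilate (t : ℝ) (Q : DyadicCube d) : Set (EuclideanSpace ℝ (Fin d)) :=
  {x | ∀ i, |x i - Q.center i| < t * Q.side / 2}

/-- Two cubes are neighbours when their closures meet. -/
def Neighbor (Q S : DyadicCube d) : Prop := (closure Q.toSet ∩ closure S.toSet).Nonempty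

end DyadicCube

/-- The Euclidean distance `dist(A, B)` of two nonempty sets. -/
def setDist {d : ℕ} (A B : Set (EuclideanSpace ℝ (Fin d))) : ℝ :=
  ⨅ x : A, Metric.infDist (x : EuclideanSpace ℝ (Fin d)) B

/-- The long distance `D(Q, S) = ℓ(Q) + dist(Q, S) + ℓ(S)`. -/
def longDist {d : ℕ} (Q S : DyadicCube d) : ℝ :=
  Q.side + setDist Q.toSet S.toSet + S.side

/-- `W` is a Whitney covering of `Ω`. (For `Ω = ℝ^d` the boundary is empty, `setDist` is `0` and
the lower bound below fails, so there is no Whitney covering, as usual.) -/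
structure IsWhitneyCovering {d : ℕ} (W : Set (DyadicCube d))
    (Ω : Set (EuclideanSpace ℝ (Fin d))) : Prop where
  disjoint : W.PairwiseDisjoint DyadicCube.toSet
  union_eq : ⋃ Q ∈ W, closure Q.toSet = Ω
  dist_boundary : ∃ c : ℝ, 0 < c ∧ ∀ Q ∈ W,
    c * Q.side ≤ setDist Q.toSet (frontier Ω) ∧ setDist Q.toSet (frontier Ω) ≤ 4 * c * Q.side
  finite_superposition : ∃ N : ℕ, ∀ x, {Q ∈ W | x ∈ Q.dilate 50}.encard ≤ N
  side_ge : ∀ Q ∈ W, ∀ S ∈ W, S.toSet ⊆ Q.dilate 5 → Q.side / 2 ≤ S.side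

/-- `(c 0, …, c m)` is an `ε`-admissible chain of cubes of `W` connecting `Q` and `S`. -/
structure IsAdmissibleChain {d : ℕ} (W : Set (DyadicCube d)) (ε : ℝ) (Q S : DyadicCube d)
    (m : ℕ) (c : ℕ → DyadicCube d) : Prop where
  first : c 0 = Q
  last : c m = S
  mem : ∀ j ≤ m, c j ∈ W
  neighbor : ∀ j < m, (c j).Neighbor (c (j + 1))
  length_le : ∑ j ∈ Finset.range (m + 1), (c j).side ≤ 1 / ε * longDist Q S
  central : ∃ j₀ ≤ m, (∀ j ≤ j₀, ε * longDist Q (c j) ≤ (c j).side) ∧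
    (∀ j, j₀ ≤ j → j ≤ m → ε * longDist (c j) S ≤ (c j).side)

/-- `Ω` is an `ε`-uniform domain and `W` is an admissible Whitney covering witnessing it. -/
structure IsUniformDomainWith {d : ℕ} (ε : ℝ) (W : Set (DyadicCube d))
    (Ω : Set (EuclideanSpace ℝ (Fin d))) : Prop where
  isOpen : IsOpen Ω
  isConnected : IsConnected Ω
  whitney : IsWhitneyCovering W Ω
  eps_pos : 0 < ε
  exists_chain : ∀ Q ∈ W, ∀ S ∈ W, ∃ m c, IsAdmissibleChain W ε Q S m c

/-- `∫_U |f(x) - f(y)|^q / |x - y|^(sq + d) dy`. -/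
def diffIntegral {d : ℕ} (s q : ℝ) (U : Set (EuclideanSpace ℝ (Fin d)))
    (f : EuclideanSpace ℝ (Fin d) → ℂ) (x : EuclideanSpace ℝ (Fin d)) : ℝ≥0∞ :=
  ∫⁻ y in U, ‖f x - f y‖ₑ ^ q / edist x y ^ (s * q + d)

/-- The seminorm `‖f‖` of the homogeneous space `Ȧ^s_{p,q}(Ω)`, with values in `[0, ∞]`. -/
def dotASeminorm {d : ℕ} (s p q : ℝ) (Ω : Set (EuclideanSpace ℝ (Fin d)))
    (f : EuclideanSpace ℝ (Fin d) → ℂ) : ℝ≥0∞ :=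
  (∫⁻ x in Ω, diffIntegral s q Ω f x ^ (p / q)) ^ (1 / p)

/-- The seminorm in which `y` is restricted to `5Q` when `x ∈ Q`. As `f` lives on `Ω` only, the
points of `5Q` outside `Ω` are disregarded (there are none for the usual Whitney coverings). -/
def whitneyASeminorm {d : ℕ} (s p q : ℝ) (W : Set (DyadicCube d))
    (Ω : Set (EuclideanSpace ℝ (Fin d))) (f : EuclideanSpace ℝ (Fin d) → ℂ) : ℝ≥0∞ :=
  (∑' Q : W, ∫⁻ x in (Q : DyadicCube d).toSet,
    diffIntegral s q ((Q : DyadicCube d).dilate 5 ∩ Ω) f x ^ (p / q)) ^ (1 / p)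

end

/-!
The first inequality holds with constant `1`, as the cubes of `W` are disjoint subsets of `Ω`.

For the second one, let `m_Q` be the mean of `f` over `Q`, let `A_Q(x)` be the inner integral over
`5Q ∩ Ω`, and let `b_Q` be the `L^{p/q}`-mean of `A_Q` over `Q`. Two facts about Whitney cubes
follow from `ℓ(S) ≥ ℓ(Q) / 2` for `S ⊆ 5Q`: a neighbour `S` of `Q` lies in `5Q` and has comparable
size, and points `x ∈ Q`, `y ∈ S \ 5Q` satisfy `D(Q, S) ≲ |x - y|`. Hence, for `x ∈ Q`, the integral
over `y ∈ Ω \ 5Q` is estimated by splitting `f x - f y` into `f x - m_Q`, `m_Q - m_S` and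
`m_S - f y`, for `y ∈ S`. The difference `m_Q - m_S` is summed along an admissible chain from `Q` to
`S`, in which every cube is large as seen from `Q` or from `S`; Jensen's inequality with the weights
`ℓ(P)^s` and a summation over `S` bound everything by `A_Q(x) + T b(Q)`, where
`T b(Q) = ∑_P (ℓ(P) / D(Q, P))^{d+s} b_P`
(`IsUniformDomainWith.exists_diffIntegral_le`).

It remains to see that `T` is bounded on `ℓ^{p/q}` with weights `ℓ(Q)^d`
(`IsUniformDomainWith.exists_tsum_kernel_rpow_le`). No maximal function is needed: the Schur test
applies with the test function `ℓ(P)^{-δ}`, `δ` small. One of its two conditions only uses the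
disjointness of the cubes. The other one says that `∑_Q ℓ(Q)^{d-δ} (ℓ(P) / D(Q, P))^{d+s}` is at most
a multiple of `ℓ(P)^{d-δ}`, and expresses that the boundary of a uniform domain is porous. It is
proved by absorption (`IsUniformDomainWith.exists_truncated_tsum_le`): the chain from `Q` to `P`
contains cubes of all intermediate sizes which are large as seen from `Q`, so that `ℓ(Q)^{-δ}` is a
telescoping sum of `(1 - 2^{-δ}) ℓ(R)^{-δ}` over such cubes `R`, up to a multiple of `ℓ(P)^{-δ}`;
summing over `Q` first reproduces the original sum with a factor that is a
multiple of `1 - 2^{-δ} ≤ δ`, hence small.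
-/

/-! ### Jensen's inequality and the Schur test in `[0, ∞]` -/

theorem ENNReal.rpow_lintegral_le {α : Type*} [MeasurableSpace α] {μ : Measure α} {q : ℝ}
    (hq : 1 ≤ q) {a : α → ℝ≥0∞} (ha : AEMeasurable a μ) :
    (∫⁻ x, a x ∂μ) ^ q ≤ μ Set.univ ^ (q - 1) * ∫⁻ x, a x ^ q ∂μ := by
  have hq0 : 0 < q := by linarith
  have h := eLpNorm'_le_eLpNorm'_mul_rpow_measure_univ (μ := μ) (f := a) one_pos hq
    ha.aestronglyMeasurable
  simp only [eLpNorm'_eq_lintegral_enorm, enorm_eq_self, ENNReal.rpow_one, div_one] at h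
  calc (∫⁻ x, a x ∂μ) ^ q
      ≤ ((∫⁻ x, a x ^ q ∂μ) ^ (1 / q) * μ Set.univ ^ (1 - 1 / q)) ^ q := by gcongr
    _ = μ Set.univ ^ (q - 1) * ∫⁻ x, a x ^ q ∂μ := by
      rw [ENNReal.mul_rpow_of_nonneg _ _ hq0.le, ← ENNReal.rpow_mul, ← ENNReal.rpow_mul,
        one_div_mul_cancel hq0.ne', ENNReal.rpow_one, mul_comm]
      congr 2
      field_simp

theorem ENNReal.rpow_tsum_mul_le {ι : Type*} {q : ℝ} (hq : 1 ≤ q) (w a : ι → ℝ≥0∞) :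
    (∑' i, w i * a i) ^ q ≤ (∑' i, w i) ^ (q - 1) * ∑' i, w i * a i ^ q := by
  have hq0 : 0 < q := by linarith
  have hq1 : 0 ≤ 1 - q⁻¹ := by
    rw [sub_nonneg]; exact inv_le_one_of_one_le₀ hq
  have h : ∑' i, w i * a i ≤ (∑' i, w i) ^ (1 - q⁻¹) * (∑' i, w i * a i ^ q) ^ q⁻¹ := by
    rw [ENNReal.tsum_eq_iSup_sum]
    refine iSup_le fun s => (ENNReal.inner_le_weight_mul_Lp_of_nonneg s hq w a).trans ?_
    gcongr
    · exact ENNReal.sum_le_tsum s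
    · exact ENNReal.sum_le_tsum s
  calc (∑' i, w i * a i) ^ q
      ≤ ((∑' i, w i) ^ (1 - q⁻¹) * (∑' i, w i * a i ^ q) ^ q⁻¹) ^ q := by gcongr
    _ = _ := by
      rw [ENNReal.mul_rpow_of_nonneg _ _ hq0.le, ← ENNReal.rpow_mul, ← ENNReal.rpow_mul,
        inv_mul_cancel₀ hq0.ne', ENNReal.rpow_one]
      congr 2
      field_simp

/-- The Schur test on `ℓ^r` with weights `m` and test function `u`, for a nonnegative kernel. -/
theorem ENNReal.schur_test {ι : Type*} {r : ℝ} (hr : 1 ≤ r) (K : ι → ι → ℝ≥0∞)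
    (m u : ι → ℝ≥0∞) (hu0 : ∀ i, u i ≠ 0) (hut : ∀ i, u i ≠ ∞) (A B : ℝ≥0∞)
    (hA : ∀ i, ∑' j, K i j * u j ≤ A * u i)
    (hB : ∀ j, ∑' i, m i * u i ^ (r - 1) * K i j ≤ B * (m j * u j ^ (r - 1)))
    (b : ι → ℝ≥0∞) :
    ∑' i, m i * (∑' j, K i j * b j) ^ r ≤ A ^ (r - 1) * B * ∑' j, m j * b j ^ r := by
  have hr0 : 0 ≤ r - 1 := by linarith
  have hu : ∀ j, u j * (b j / u j) = b j := fun j => ENNReal.mul_div_cancel (hu0 j) (hut j)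
  have key : ∀ i, (∑' j, K i j * b j) ^ r
      ≤ (A * u i) ^ (r - 1) * ∑' j, K i j * u j * (b j / u j) ^ r := by
    intro i
    calc (∑' j, K i j * b j) ^ r = (∑' j, K i j * u j * (b j / u j)) ^ r := by
          congr 2; ext j; rw [mul_assoc, hu]
      _ ≤ (∑' j, K i j * u j) ^ (r - 1) * ∑' j, K i j * u j * (b j / u j) ^ r :=
          ENNReal.rpow_tsum_mul_le hr _ _
      _ ≤ _ := by gcongr; exact hA i
  have hswap : ∀ j, u j ^ (r - 1) * (u j * (b j / u j) ^ r) = b j ^ r := by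
    intro j
    have h1 : u j ^ (r - 1) * u j = u j ^ r := by
      conv_lhs => rw [← ENNReal.rpow_one (u j), ← ENNReal.rpow_mul, one_mul]
      rw [← ENNReal.rpow_add _ _ (hu0 j) (hut j)]; congr 1; ring
    rw [← mul_assoc, h1, ← ENNReal.mul_rpow_of_nonneg _ _ (by linarith), hu]
  calc ∑' i, m i * (∑' j, K i j * b j) ^ r
      ≤ ∑' i, m i * ((A * u i) ^ (r - 1) * ∑' j, K i j * u j * (b j / u j) ^ r) := by
        gcongr with i; exact key i
    _ = A ^ (r - 1) * ∑' i, ∑' j, m i * u i ^ (r - 1) * K i j * (u j * (b j / u j) ^ r) := by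
        rw [← ENNReal.tsum_mul_left]
        congr 1; ext i
        simp_rw [← ENNReal.tsum_mul_left, ENNReal.mul_rpow_of_nonneg _ _ hr0]
        congr 1; ext j; ring
    _ = A ^ (r - 1) * ∑' j, (∑' i, m i * u i ^ (r - 1) * K i j) * (u j * (b j / u j) ^ r) := by
        rw [ENNReal.tsum_comm]; simp_rw [ENNReal.tsum_mul_right]
    _ ≤ A ^ (r - 1) * ∑' j, B * (m j * u j ^ (r - 1)) * (u j * (b j / u j) ^ r) := by
        gcongr with j; exact hB j
    _ = A ^ (r - 1) * B * ∑' j, m j * b j ^ r := by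
        rw [mul_assoc, ← ENNReal.tsum_mul_left (a := B)]
        congr 2; ext j; rw [← hswap j]; ring

theorem ENNReal.add_three_rpow_le {q : ℝ} (hq : 1 ≤ q) (a b c : ℝ≥0∞) :
    (a + b + c) ^ q ≤ 4 ^ (q - 1) * (a ^ q + b ^ q + c ^ q) := by
  have hq0 : 0 ≤ q - 1 := by linarith
  have h2 : (1 : ℝ≥0∞) ≤ 2 ^ (q - 1) := by
    simpa using ENNReal.rpow_le_rpow (show (1 : ℝ≥0∞) ≤ 2 by norm_num) hq0
  have h4 : (4 : ℝ≥0∞) ^ (q - 1) = 2 ^ (q - 1) * 2 ^ (q - 1) := by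
    rw [← ENNReal.mul_rpow_of_nonneg _ _ hq0]; norm_num
  calc (a + b + c) ^ q ≤ 2 ^ (q - 1) * ((a + b) ^ q + c ^ q) :=
        ENNReal.rpow_add_le_mul_rpow_add_rpow _ _ hq
    _ ≤ 2 ^ (q - 1) * (2 ^ (q - 1) * (a ^ q + b ^ q) + 2 ^ (q - 1) * c ^ q) := by
        gcongr
        · exact ENNReal.rpow_add_le_mul_rpow_add_rpow _ _ hq
        · exact le_mul_of_one_le_left' h2
    _ = _ := by rw [h4]; ring

/-! ### Geometry of dyadic cubes -/

theorem EuclideanSpace.dist_le_card_mul {d : ℕ} {x y : EuclideanSpace ℝ (Fin d)} {a : ℝ}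
    (ha : 0 ≤ a) (h : ∀ i, |x i - y i| ≤ a) : dist x y ≤ d * a := by
  rw [EuclideanSpace.dist_eq]
  refine Real.sqrt_le_iff.mpr ⟨by positivity, ?_⟩
  calc ∑ i, dist (x i) (y i) ^ 2 ≤ ∑ _i : Fin d, a ^ 2 := by
        gcongr with i
        rw [Real.dist_eq]; exact h i
    _ = d * a ^ 2 := by simp
    _ ≤ (d * a) ^ 2 := by
        have : (d : ℝ) ≤ (d : ℝ) ^ 2 := by exact_mod_cast Nat.le_self_pow two_ne_zero d
        rw [mul_pow]; gcongr

theorem EuclideanSpace.abs_sub_le_dist {d : ℕ} (x y : EuclideanSpace ℝ (Fin d)) (i : Fin d) :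
    |x i - y i| ≤ dist x y := by
  rw [dist_eq_norm]; simpa using PiLp.norm_apply_le (x - y) i

namespace DyadicCube

variable {d : ℕ}

theorem side_pos (Q : DyadicCube d) : 0 < Q.side := by unfold side; positivity

theorem mem_toSet_iff (Q : DyadicCube d) (x : EuclideanSpace ℝ (Fin d)) :
    x ∈ Q.toSet ↔ ∀ i, |x i - Q.center i| < Q.side / 2 := by
  simp only [toSet, Set.mem_ofPred_eq, Set.mem_Ioo, center, abs_lt]
  refine forall_congr' fun i => ⟨fun h => ⟨by linarith, by linarith⟩,
    fun h => ⟨by linarith, by linarith⟩⟩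

theorem toSet_eq_preimage (Q : DyadicCube d) : Q.toSet =
    (MeasurableEquiv.toLp 2 (Fin d → ℝ)).symm ⁻¹'
      Set.univ.pi fun i => Set.Ioo ((Q.index i : ℝ) * Q.side) (((Q.index i : ℝ) + 1) * Q.side) := by
  ext x; simp [toSet]

theorem isOpen_toSet (Q : DyadicCube d) : IsOpen Q.toSet := by
  have : Q.toSet = ⋂ i, (fun x : EuclideanSpace ℝ (Fin d) => x i) ⁻¹'
      Set.Ioo ((Q.index i : ℝ) * Q.side) (((Q.index i : ℝ) + 1) * Q.side) := by
    ext x; simp [toSet]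
  rw [this]
  exact isOpen_iInter_of_finite fun i => isOpen_Ioo.preimage (by fun_prop)

theorem isOpen_dilate (t : ℝ) (Q : DyadicCube d) : IsOpen (Q.dilate t) := by
  have : Q.dilate t = ⋂ i, (fun x : EuclideanSpace ℝ (Fin d) => |x i - Q.center i|) ⁻¹'
      Set.Iio (t * Q.side / 2) := by
    ext x; simp [dilate]
  rw [this]
  exact isOpen_iInter_of_finite fun i => isOpen_Iio.preimage (by fun_prop)

theorem measurableSet_toSet (Q : DyadicCube d) : MeasurableSet Q.toSet :=
  Q.isOpen_toSet.measurableSet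

theorem convex_toSet (Q : DyadicCube d) : Convex ℝ Q.toSet := by
  intro x hx y hy a b ha hb hab i
  have := (convex_Ioo ((Q.index i : ℝ) * Q.side) (((Q.index i : ℝ) + 1) * Q.side))
    (hx i) (hy i) ha hb hab
  simpa using this

theorem volume_toSet (Q : DyadicCube d) : volume Q.toSet = ENNReal.ofReal (Q.side ^ (d : ℝ)) := by
  rw [toSet_eq_preimage, (EuclideanSpace.volume_preserving_symm_measurableEquiv_toLp
    (Fin d)).measure_preimage_equiv, Real.volume_pi_Ioo]
  have : ∀ i, (((Q.index i : ℝ) + 1) * Q.side) - (Q.index i : ℝ) * Q.side = Q.side := by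
    intro i; ring
  simp [this, ENNReal.ofReal_pow Q.side_pos.le]

theorem volume_closure_diff (Q : DyadicCube d) : volume (closure Q.toSet \ Q.toSet) = 0 := by
  have := Q.convex_toSet.addHaar_frontier volume
  rwa [frontier, Q.isOpen_toSet.interior_eq] at this

/-- The centre of a cube as a point of the Euclidean space. -/
noncomputable def centerPoint (Q : DyadicCube d) : EuclideanSpace ℝ (Fin d) := WithLp.toLp 2 Q.center

theorem centerPoint_mem (Q : DyadicCube d) : Q.centerPoint ∈ Q.toSet := by
  rw [mem_toSet_iff]; intro i; simp [centerPoint, Q.side_pos]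

theorem nonempty_toSet (Q : DyadicCube d) : Q.toSet.Nonempty := ⟨_, Q.centerPoint_mem⟩

theorem dist_centerPoint_le {Q : DyadicCube d} {x : EuclideanSpace ℝ (Fin d)} (hx : x ∈ Q.toSet) :
    dist x Q.centerPoint ≤ d * (Q.side / 2) :=
  EuclideanSpace.dist_le_card_mul (by linarith [Q.side_pos])
    fun i => ((Q.mem_toSet_iff x).1 hx i).le

theorem abs_sub_center_le_of_mem_closure {Q : DyadicCube d} {x : EuclideanSpace ℝ (Fin d)}
    (hx : x ∈ closure Q.toSet) (i : Fin d) : |x i - Q.center i| ≤ Q.side / 2 := by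
  have hc : IsClosed {x : EuclideanSpace ℝ (Fin d) | |x i - Q.center i| ≤ Q.side / 2} :=
    isClosed_le (by fun_prop) continuous_const
  exact closure_minimal (fun y hy => ((Q.mem_toSet_iff y).1 hy i).le) hc hx

theorem isCompact_closure_toSet (Q : DyadicCube d) : IsCompact (closure Q.toSet) := by
  refine Metric.isCompact_of_isClosed_isBounded isClosed_closure (Metric.isBounded_closure_iff.2 ?_)
  exact (Metric.isBounded_iff_subset_closedBall Q.centerPoint).2
    ⟨_, fun x hx => Metric.mem_closedBall.2 (dist_centerPoint_le hx)⟩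

theorem toSet_subset_dilate (Q : DyadicCube d) : Q.toSet ⊆ Q.dilate 5 := by
  intro x hx i
  have := (Q.mem_toSet_iff x).1 hx i
  linarith [Q.side_pos]

instance : Countable (DyadicCube d) :=
  Function.Injective.countable (f := fun Q : DyadicCube d => (Q.scale, Q.index)) (by
    rintro ⟨a, b⟩ ⟨a', b'⟩ h; simpa using h)

theorem Neighbor.symm {Q S : DyadicCube d} (h : Q.Neighbor S) : S.Neighbor Q := by
  unfold Neighbor at *; rwa [Set.inter_comm]

theorem Neighbor.subset_dilate {Q S : DyadicCube d} (h : Q.Neighbor S)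
    (hs : S.side ≤ 2 * Q.side) : S.toSet ⊆ Q.dilate 5 := by
  obtain ⟨z, hzQ, hzS⟩ := h
  intro x hx i
  have h1 := abs_lt.1 ((S.mem_toSet_iff x).1 hx i)
  have h2 := abs_le.1 (abs_sub_center_le_of_mem_closure hzQ i)
  have h3 := abs_le.1 (abs_sub_center_le_of_mem_closure hzS i)
  rw [abs_lt]
  constructor <;> linarith

/-- A variant of the long distance measured between the centres of the cubes. It is comparable to
`longDist` and satisfies the triangle inequality. -/
noncomputable def centerDist (Q S : DyadicCube d) : ℝ := Q.side + dist Q.centerPoint S.centerPoint + S.side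

theorem centerDist_comm (Q S : DyadicCube d) : Q.centerDist S = S.centerDist Q := by
  unfold centerDist; rw [dist_comm]; ring

theorem side_le_centerDist (Q S : DyadicCube d) : Q.side ≤ Q.centerDist S := by
  unfold centerDist; linarith [S.side_pos, dist_nonneg (x := Q.centerPoint) (y := S.centerPoint)]

theorem side_le_centerDist' (Q S : DyadicCube d) : S.side ≤ Q.centerDist S := by
  rw [centerDist_comm]; exact side_le_centerDist _ _

theorem centerDist_pos (Q S : DyadicCube d) : 0 < Q.centerDist S :=
  Q.side_pos.trans_le (side_le_centerDist _ _)

theorem centerDist_triangle (Q R S : DyadicCube d) :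
    Q.centerDist S ≤ Q.centerDist R + R.centerDist S := by
  unfold centerDist
  linarith [R.side_pos, dist_triangle Q.centerPoint R.centerPoint S.centerPoint]

theorem longDist_le_centerDist (Q S : DyadicCube d) : longDist Q S ≤ Q.centerDist S := by
  unfold longDist centerDist
  have h : setDist Q.toSet S.toSet ≤ dist Q.centerPoint S.centerPoint := by
    refine (ciInf_le ⟨0, ?_⟩ (⟨_, Q.centerPoint_mem⟩ : Q.toSet)).trans
      (Metric.infDist_le_dist_of_mem S.centerPoint_mem)
    rintro _ ⟨x, rfl⟩; exact Metric.infDist_nonneg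
  linarith

theorem centerDist_le_longDist (Q S : DyadicCube d) :
    Q.centerDist S ≤ (1 + d) * longDist Q S := by
  have h : dist Q.centerPoint S.centerPoint - d * (Q.side / 2) - d * (S.side / 2)
      ≤ setDist Q.toSet S.toSet := by
    have : Nonempty Q.toSet := ⟨_, Q.centerPoint_mem⟩
    refine le_ciInf fun x => (Metric.le_infDist S.nonempty_toSet).2 fun y hy => ?_
    have h1 := dist_centerPoint_le x.2
    have h2 := dist_centerPoint_le hy
    have h3 := dist_triangle4 Q.centerPoint (x : EuclideanSpace ℝ (Fin d)) y S.centerPoint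
    rw [dist_comm Q.centerPoint (x : EuclideanSpace ℝ (Fin d))] at h3
    linarith
  have h0 : 0 ≤ setDist Q.toSet S.toSet := Real.iInf_nonneg fun x => Metric.infDist_nonneg
  have hd : (0 : ℝ) ≤ d := Nat.cast_nonneg d
  have h1 := mul_nonneg hd h0
  have h2 := mul_nonneg hd Q.side_pos.le
  have h3 := mul_nonneg hd S.side_pos.le
  unfold longDist centerDist
  nlinarith

/-- Up to the factor `1 + d`, points of a cube `P` are not farther from the centre of `Q` than the
long distance `D(Q, P)`. -/
theorem add_dist_le_centerDist {Q P : DyadicCube d} {R : ℝ} (hR : 0 ≤ R)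
    {y : EuclideanSpace ℝ (Fin d)} (hy : y ∈ P.toSet) :
    R + dist y Q.centerPoint ≤ (1 + d) * (R + Q.centerDist P) := by
  have h1 := dist_centerPoint_le hy
  have h2 := dist_triangle y P.centerPoint Q.centerPoint
  have hd : (0 : ℝ) ≤ d := Nat.cast_nonneg d
  have h3 := mul_nonneg hd hR
  have h4 := mul_nonneg hd Q.side_pos.le
  have h5 := mul_nonneg hd (dist_nonneg (x := Q.centerPoint) (y := P.centerPoint))
  have h6 := mul_nonneg hd P.side_pos.le
  have h7 := Q.side_pos
  have h8 := P.side_pos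
  unfold centerDist
  rw [dist_comm P.centerPoint] at h2
  nlinarith

end DyadicCube

namespace IsWhitneyCovering

variable {d : ℕ} {W : Set (DyadicCube d)} {Ω : Set (EuclideanSpace ℝ (Fin d))}

theorem side_le_two_mul (hW : IsWhitneyCovering W Ω) {Q S : DyadicCube d} (hQ : Q ∈ W)
    (hS : S ∈ W) (h : Q.Neighbor S) : S.side ≤ 2 * Q.side := by
  rcases le_total S.side Q.side with hle | hle
  · linarith [Q.side_pos]
  · have := hW.side_ge S hS Q hQ (h.symm.subset_dilate (by linarith [S.side_pos]))
    linarith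

theorem subset_dilate (hW : IsWhitneyCovering W Ω) {Q S : DyadicCube d} (hQ : Q ∈ W)
    (hS : S ∈ W) (h : Q.Neighbor S) : S.toSet ⊆ Q.dilate 5 :=
  h.subset_dilate (hW.side_le_two_mul hQ hS h)

theorem closure_subset (hW : IsWhitneyCovering W Ω) {Q : DyadicCube d} (hQ : Q ∈ W) :
    closure Q.toSet ⊆ Ω := by
  rw [← hW.union_eq]; exact Set.subset_biUnion_of_mem (u := fun Q => closure Q.toSet) hQ

theorem toSet_subset (hW : IsWhitneyCovering W Ω) {Q : DyadicCube d} (hQ : Q ∈ W) :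
    Q.toSet ⊆ Ω := subset_closure.trans (hW.closure_subset hQ)

/-- Points `x ∈ Q` and `y ∈ S \ 5Q` are at distance at least a multiple of the long distance of the
cubes: a cube `S` so large that `x` is deep inside `5S` would contradict `ℓ(Q) ≥ ℓ(S) / 2`. -/
theorem centerDist_le_dist (hW : IsWhitneyCovering W Ω) {Q S : DyadicCube d} (hQ : Q ∈ W)
    (hS : S ∈ W) {x y : EuclideanSpace ℝ (Fin d)} (hx : x ∈ Q.toSet) (hy : y ∈ S.toSet)
    (hy5 : y ∉ Q.dilate 5) : Q.centerDist S ≤ 4 * (1 + d) * dist x y := by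
  have hxQ := (Q.mem_toSet_iff x).1 hx
  have hyS := (S.mem_toSet_iff y).1 hy
  have hQ0 := Q.side_pos
  have hS0 := S.side_pos
  have h1 : 2 * Q.side ≤ dist x y := by
    simp only [DyadicCube.dilate, Set.mem_ofPred_eq, not_forall, not_lt] at hy5
    obtain ⟨i, hi⟩ := hy5
    have e1 := EuclideanSpace.abs_sub_le_dist x y i
    have e2 := hxQ i
    have e3 : |y i - Q.center i| ≤ |x i - y i| + |x i - Q.center i| := by
      rw [abs_sub_comm (x i) (y i)]; exact abs_sub_le _ _ _
    linarith
  have h2 : S.side ≤ 2 * dist x y := by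
    by_cases hc : S.side ≤ 4 * Q.side
    · linarith
    push Not at hc
    have hns : ¬ Q.toSet ⊆ S.dilate 5 := fun hsub => by
      have := hW.side_ge S hS Q hQ hsub
      linarith
    obtain ⟨z, hzQ, hz⟩ := Set.not_subset.1 hns
    simp only [DyadicCube.dilate, Set.mem_ofPred_eq, not_forall, not_lt] at hz
    obtain ⟨i, hi⟩ := hz
    have e1 := EuclideanSpace.abs_sub_le_dist x y i
    have e2 := abs_lt.1 (hxQ i)
    have e3 := abs_lt.1 ((Q.mem_toSet_iff z).1 hzQ i)
    have e4 := abs_lt.1 (hyS i)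
    have e5 := abs_le.1 (e1.trans le_rfl)
    rcases le_abs.1 hi with h | h <;> linarith
  have h3 := DyadicCube.dist_centerPoint_le hx
  have h4 := DyadicCube.dist_centerPoint_le hy
  have h5 := dist_triangle4 Q.centerPoint x y S.centerPoint
  rw [dist_comm Q.centerPoint x] at h5
  have hd : (0 : ℝ) ≤ d := Nat.cast_nonneg d
  have h6 := mul_le_mul_of_nonneg_left h1 hd
  have h7 := mul_le_mul_of_nonneg_left h2 hd
  unfold DyadicCube.centerDist
  have h8 := mul_nonneg hd (dist_nonneg (x := x) (y := y))
  nlinarith [dist_nonneg (x := x) (y := y)]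

end IsWhitneyCovering

/-! ### Summation over disjoint cubes -/

theorem exists_lintegral_add_dist_rpow_le (d : ℕ) {η : ℝ} (hη : 0 < η) :
    ∃ C : ℝ≥0, ∀ (c : EuclideanSpace ℝ (Fin d)) (R : ℝ), 0 < R →
      ∫⁻ y, ENNReal.ofReal ((R + dist y c) ^ (-(d + η))) ≤ C * ENNReal.ofReal (R ^ (-η)) := by
  have hfin : ∫⁻ x : EuclideanSpace ℝ (Fin d), ENNReal.ofReal ((1 + ‖x‖) ^ (-(d + η))) < ∞ :=
    finite_integral_one_add_norm (by simpa using hη)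
  set I := ∫⁻ x : EuclideanSpace ℝ (Fin d), ENNReal.ofReal ((1 + ‖x‖) ^ (-(d + η))) with hI
  refine ⟨I.toNNReal, fun c R hR => ?_⟩
  rw [ENNReal.coe_toNNReal hfin.ne]
  have hpt : ∀ y : EuclideanSpace ℝ (Fin d), ENNReal.ofReal ((R + ‖y‖) ^ (-(d + η)))
      = ENNReal.ofReal (R ^ (-(d + η))) *
        ENNReal.ofReal ((1 + ‖R⁻¹ • y‖) ^ (-(d + η))) := by
    intro y
    rw [← ENNReal.ofReal_mul (by positivity), ← Real.mul_rpow hR.le (by positivity), norm_smul,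
      Real.norm_of_nonneg (by positivity)]
    congr 2
    field_simp
  have hmeas : Measurable fun y : EuclideanSpace ℝ (Fin d) =>
      ENNReal.ofReal ((1 + ‖y‖) ^ (-(d + η))) := by fun_prop
  have hscale : ∫⁻ y : EuclideanSpace ℝ (Fin d), ENNReal.ofReal ((1 + ‖R⁻¹ • y‖) ^ (-(d + η)))
      = ENNReal.ofReal (R ^ (d : ℝ)) * I := by
    rw [← lintegral_map (f := fun y : EuclideanSpace ℝ (Fin d) =>
        ENNReal.ofReal ((1 + ‖y‖) ^ (-(d + η)))) (g := fun y => R⁻¹ • y) hmeas (by fun_prop),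
      Measure.map_addHaar_smul _ (by positivity), lintegral_smul_measure, ← hI]
    simp [abs_of_pos hR]
  refine le_of_eq ?_
  simp_rw [dist_eq_norm]
  rw [lintegral_sub_right_eq_self (fun y : EuclideanSpace ℝ (Fin d) =>
    ENNReal.ofReal ((R + ‖y‖) ^ (-(d + η)))) c]
  simp_rw [hpt]
  rw [lintegral_const_mul _ (by fun_prop), hscale, ← mul_assoc,
    ← ENNReal.ofReal_mul (by positivity), ← Real.rpow_add hR, mul_comm]
  congr 3
  ring

namespace DyadicCube

variable {d : ℕ}

theorem tsum_setLIntegral_le {W : Set (DyadicCube d)} (hW : W.PairwiseDisjoint toSet)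
    (g : EuclideanSpace ℝ (Fin d) → ℝ≥0∞) :
    ∑' P : W, ∫⁻ y in P.1.toSet, g y ≤ ∫⁻ y, g y := by
  rw [← lintegral_iUnion (fun P : W => P.1.measurableSet_toSet)
    (fun P P' hne => hW P.2 P'.2 fun h => hne (Subtype.ext h))]
  exact setLIntegral_le_lintegral _ _

/-- A disjoint family of cubes sums the kernel `ℓ(P)^d (R + D(Q, P))^{-d-η}` like the integral of
`(R + |y - c|)^{-d-η}`. -/
theorem exists_tsum_kernel_le (d : ℕ) {η : ℝ} (hη : 0 < η) :
    ∃ C : ℝ≥0, ∀ (W : Set (DyadicCube d)), W.PairwiseDisjoint toSet →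
      ∀ (Q : DyadicCube d) (R : ℝ), 0 < R →
      ∑' P : W, ENNReal.ofReal (P.1.side ^ (d : ℝ) * (R + Q.centerDist P) ^ (-(d + η)))
        ≤ C * ENNReal.ofReal (R ^ (-η)) := by
  obtain ⟨C, hC⟩ := exists_lintegral_add_dist_rpow_le d hη
  refine ⟨(1 + d) ^ ((d : ℝ) + η) * C, fun W hW Q R hR => ?_⟩
  have hpt : ∀ P : W, ENNReal.ofReal (P.1.side ^ (d : ℝ) * (R + Q.centerDist P) ^ (-(d + η)))
      ≤ ((1 + d) ^ ((d : ℝ) + η) : ℝ≥0) * ∫⁻ y in P.1.toSet,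
        ENNReal.ofReal ((R + dist y Q.centerPoint) ^ (-(d + η))) := by
    intro P
    have hD := Q.centerDist_pos P
    have h1 : ∀ y ∈ P.1.toSet, ENNReal.ofReal ((R + Q.centerDist P) ^ (-(d + η)))
        ≤ ((1 + d) ^ ((d : ℝ) + η) : ℝ≥0) *
          ENNReal.ofReal ((R + dist y Q.centerPoint) ^ (-(d + η))) := by
      intro y hy
      have hle := add_dist_le_centerDist (Q := Q) hR.le hy
      have hy0 : 0 < R + dist y Q.centerPoint := by positivity
      have hcoe : (((1 + d) ^ ((d : ℝ) + η) : ℝ≥0) : ℝ≥0∞)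
          = ENNReal.ofReal ((1 + d) ^ ((d : ℝ) + η)) := by
        rw [ENNReal.ofReal, ENNReal.coe_inj, ← NNReal.coe_inj]
        rw [Real.coe_toNNReal _ (by positivity)]; push_cast; rfl
      rw [hcoe, ← ENNReal.ofReal_mul (by positivity)]
      refine ENNReal.ofReal_le_ofReal ?_
      have h2 : ((1 + d) * (R + Q.centerDist P)) ^ (-(d + η))
          ≤ (R + dist y Q.centerPoint) ^ (-(d + η)) :=
        Real.rpow_le_rpow_of_nonpos hy0 hle (by linarith [(Nat.cast_nonneg d : (0 : ℝ) ≤ d)])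
      calc (R + Q.centerDist P) ^ (-(d + η))
          = (1 + d) ^ ((d : ℝ) + η) * ((1 + d) * (R + Q.centerDist P)) ^ (-(d + η)) := by
            rw [Real.mul_rpow (by positivity) (by positivity), ← mul_assoc,
              ← Real.rpow_add (by positivity), add_neg_cancel, Real.rpow_zero, one_mul]
        _ ≤ _ := by gcongr
    calc ENNReal.ofReal (P.1.side ^ (d : ℝ) * (R + Q.centerDist P) ^ (-(d + η)))
        = ∫⁻ _y in P.1.toSet, ENNReal.ofReal ((R + Q.centerDist P) ^ (-(d + η))) := by
          rw [setLIntegral_const, volume_toSet, ENNReal.ofReal_mul (by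
            have := P.1.side_pos; positivity), mul_comm]
      _ ≤ ∫⁻ y in P.1.toSet, ((1 + d) ^ ((d : ℝ) + η) : ℝ≥0) *
            ENNReal.ofReal ((R + dist y Q.centerPoint) ^ (-(d + η))) :=
          setLIntegral_mono' P.1.measurableSet_toSet h1
      _ = _ := lintegral_const_mul _ (by fun_prop)
  calc ∑' P : W, ENNReal.ofReal (P.1.side ^ (d : ℝ) * (R + Q.centerDist P) ^ (-(d + η)))
      ≤ ∑' P : W, ((1 + d) ^ ((d : ℝ) + η) : ℝ≥0) * ∫⁻ y in P.1.toSet,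
        ENNReal.ofReal ((R + dist y Q.centerPoint) ^ (-(d + η))) := ENNReal.tsum_le_tsum hpt
    _ ≤ ((1 + d) ^ ((d : ℝ) + η) : ℝ≥0) * (C * ENNReal.ofReal (R ^ (-η))) := by
      rw [ENNReal.tsum_mul_left]
      gcongr
      exact (tsum_setLIntegral_le hW _).trans (hC _ R hR)
    _ = _ := by rw [ENNReal.coe_mul, mul_assoc]

open Classical in
theorem exists_tsum_tail_le (d : ℕ) {η : ℝ} (hη : 0 < η) :
    ∃ C : ℝ≥0, ∀ (W : Set (DyadicCube d)), W.PairwiseDisjoint toSet →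
      ∀ (Q : DyadicCube d) (R : ℝ), 0 < R →
      (∑' P : W, if R ≤ Q.centerDist P then
        ENNReal.ofReal (P.1.side ^ (d : ℝ) * Q.centerDist P ^ (-(d + η))) else 0)
        ≤ C * ENNReal.ofReal (R ^ (-η)) := by
  obtain ⟨C, hC⟩ := exists_tsum_kernel_le d hη
  refine ⟨(2 ^ ((d : ℝ) + η) : ℝ).toNNReal * C, fun W hW Q R hR => ?_⟩
  rw [ENNReal.coe_mul, mul_assoc]
  refine le_trans ?_ (mul_le_mul_right (hC W hW Q R hR) _)
  rw [← ENNReal.tsum_mul_left]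
  refine ENNReal.tsum_le_tsum fun P => ?_
  split_ifs with h
  · have hD := Q.centerDist_pos P
    have hP := P.1.side_pos
    change _ ≤ ENNReal.ofReal _ * _
    rw [← ENNReal.ofReal_mul (by positivity)]
    refine ENNReal.ofReal_le_ofReal ?_
    have h2 : (2 * Q.centerDist P) ^ (-(d + η)) ≤ (R + Q.centerDist P) ^ (-(d + η)) :=
      Real.rpow_le_rpow_of_nonpos (by positivity) (by linarith)
        (by linarith [(Nat.cast_nonneg d : (0 : ℝ) ≤ d)])
    calc P.1.side ^ (d : ℝ) * Q.centerDist P ^ (-(d + η))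
        = 2 ^ ((d : ℝ) + η) * (P.1.side ^ (d : ℝ) * (2 * Q.centerDist P) ^ (-(d + η))) := by
          rw [Real.mul_rpow (by positivity) (by positivity), Real.rpow_neg two_pos.le,
            Real.rpow_neg hD.le]
          field_simp
      _ ≤ _ := by gcongr
  · exact zero_le

open Classical in
/-- The cubes of a disjoint family that lie at long distance at most `ρ / κ` from `Q` have total
volume at most a multiple of `ρ^d`. -/
theorem exists_tsum_packing_le (d : ℕ) {κ : ℝ} (hκ : 0 < κ) :
    ∃ C : ℝ≥0, ∀ (W : Set (DyadicCube d)), W.PairwiseDisjoint toSet →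
      ∀ (Q : DyadicCube d) (ρ : ℝ), 0 < ρ →
      (∑' P : W, if κ * Q.centerDist P ≤ ρ then ENNReal.ofReal (P.1.side ^ (d : ℝ)) else 0)
        ≤ C * ENNReal.ofReal (ρ ^ (d : ℝ)) := by
  obtain ⟨C, hC⟩ := exists_tsum_kernel_le d one_pos
  refine ⟨((1 + 1 / κ) ^ ((d : ℝ) + 1) : ℝ).toNNReal * C, fun W hW Q ρ hρ => ?_⟩
  have hρ' : ENNReal.ofReal (ρ ^ (d : ℝ))
      = ENNReal.ofReal (ρ ^ ((d : ℝ) + 1)) * ENNReal.ofReal (ρ ^ (-1 : ℝ)) := by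
    rw [← ENNReal.ofReal_mul (by positivity), ← Real.rpow_add hρ]; congr 2; ring
  calc _ ≤ ∑' P : W, ENNReal.ofReal ((1 + 1 / κ) ^ ((d : ℝ) + 1)) *
        (ENNReal.ofReal (ρ ^ ((d : ℝ) + 1)) *
          ENNReal.ofReal (P.1.side ^ (d : ℝ) * (ρ + Q.centerDist P) ^ (-(d + 1 : ℝ)))) := by
        refine ENNReal.tsum_le_tsum fun P => ?_
        split_ifs with h
        · have hD := Q.centerDist_pos P
          have hP := P.1.side_pos
          rw [← ENNReal.ofReal_mul (by positivity), ← ENNReal.ofReal_mul (by positivity)]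
          refine ENNReal.ofReal_le_ofReal ?_
          have h1 : ρ + Q.centerDist P ≤ (1 + 1 / κ) * ρ := by
            rw [add_mul, one_mul, one_div, inv_mul_eq_div]
            gcongr
            rwa [le_div_iff₀' hκ]
          have h2 : ((1 + 1 / κ) * ρ) ^ (-(d + 1 : ℝ)) ≤ (ρ + Q.centerDist P) ^ (-(d + 1 : ℝ)) :=
            Real.rpow_le_rpow_of_nonpos (by positivity) h1
              (by linarith [(Nat.cast_nonneg d : (0 : ℝ) ≤ d)])
          calc P.1.side ^ (d : ℝ) = (1 + 1 / κ) ^ ((d : ℝ) + 1) * (ρ ^ ((d : ℝ) + 1) *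
                (P.1.side ^ (d : ℝ) * ((1 + 1 / κ) * ρ) ^ (-(d + 1 : ℝ)))) := by
                rw [Real.rpow_neg (by positivity), Real.mul_rpow (by positivity) hρ.le]
                field_simp
            _ ≤ _ := by gcongr
        · exact zero_le
    _ ≤ _ := by
        rw [ENNReal.tsum_mul_left, ENNReal.tsum_mul_left, ENNReal.coe_mul, hρ', mul_assoc,
          mul_left_comm (C : ℝ≥0∞)]
        gcongr
        · exact le_rfl
        · exact hC W hW Q ρ hρ

open Classical in
/-- The cubes `P` of side at most `R` which are large as seen from `Q`: there are boundedly many of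
each size, so the sum of `ℓ(P)^s` is dominated by a geometric series. -/
theorem exists_tsum_side_rpow_le (d : ℕ) {κ s : ℝ} (hκ : 0 < κ) (hs : 0 < s) :
    ∃ C : ℝ≥0, ∀ (W : Set (DyadicCube d)), W.PairwiseDisjoint toSet →
      ∀ (Q : DyadicCube d) (R : ℝ), 0 < R →
      (∑' P : W, if κ * Q.centerDist P ≤ P.1.side ∧ P.1.side ≤ R then
        ENNReal.ofReal (P.1.side ^ s) else 0) ≤ C * ENNReal.ofReal (R ^ s) := by
  obtain ⟨C, hC⟩ := exists_tsum_packing_le d hκ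
  set t : ℝ := 2 ^ (-s) with ht
  have ht0 : 0 < t := by positivity
  have ht1 : t < 1 := Real.rpow_lt_one_of_one_lt_of_neg one_lt_two (by linarith)
  have hgeom : ∑' n : ℕ, ENNReal.ofReal (t ^ n) = ENNReal.ofReal ((1 - t)⁻¹) := by
    rw [← ENNReal.ofReal_tsum_of_nonneg (fun n => by positivity)
      (summable_geometric_of_lt_one ht0.le ht1), tsum_geometric_of_lt_one ht0.le ht1]
  refine ⟨C * ((1 - t)⁻¹).toNNReal, fun W hW Q R hR => ?_⟩
  set k₀ : ℤ := Int.log 2 R with hk₀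
  -- the count of the cubes of side `2 ^ k`
  have hcount : ∀ k : ℤ, (∑' P : W, if κ * Q.centerDist P ≤ P.1.side ∧ P.1.scale = k then
      (1 : ℝ≥0∞) else 0) ≤ C := by
    intro k
    have hk : (0 : ℝ) < ((2 : ℝ) ^ k) ^ (d : ℝ) := by positivity
    have hk' : ENNReal.ofReal (((2 : ℝ) ^ k) ^ (d : ℝ)) ≠ 0 := by simpa using hk
    refine (ENNReal.mul_le_mul_iff_left hk' ENNReal.ofReal_ne_top).1 ?_
    refine le_trans ?_ (hC W hW Q (2 ^ k) (by positivity))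
    rw [← ENNReal.tsum_mul_right]
    refine ENNReal.tsum_le_tsum fun P => ?_
    by_cases h : κ * Q.centerDist P ≤ P.1.side ∧ P.1.scale = k
    · have : P.1.side = 2 ^ k := by rw [side, h.2]
      rw [if_pos h, if_pos (this ▸ h.1), this, one_mul]
    · rw [if_neg h, zero_mul]; exact zero_le
  have hpow : ∀ n : ℕ, ((2 : ℝ) ^ (k₀ - (n : ℤ))) ^ s ≤ R ^ s * t ^ n := by
    intro n
    have h1 : ((2 : ℝ) ^ (k₀ - (n : ℤ))) = 2 ^ k₀ * ((2 : ℝ) ^ n)⁻¹ := by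
      rw [zpow_sub₀ two_ne_zero, zpow_natCast, div_eq_mul_inv]
    have h2 : (((2 : ℝ) ^ n)⁻¹) ^ s = t ^ n := by
      rw [ht, ← Real.rpow_natCast, ← Real.rpow_natCast, ← Real.rpow_neg two_pos.le,
        ← Real.rpow_mul two_pos.le, ← Real.rpow_mul two_pos.le]
      congr 1; ring
    rw [h1, Real.mul_rpow (by positivity) (by positivity), h2]
    gcongr
    have := Int.zpow_log_le_self (b := 2) one_lt_two hR
    exact_mod_cast this
  calc _ ≤ ∑' P : W, ∑' n : ℕ, ENNReal.ofReal (R ^ s * t ^ n) *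
        (if κ * Q.centerDist P ≤ P.1.side ∧ P.1.scale = k₀ - n then (1 : ℝ≥0∞) else 0) := by
        refine ENNReal.tsum_le_tsum fun P => ?_
        by_cases h : κ * Q.centerDist P ≤ P.1.side ∧ P.1.side ≤ R
        · have hle : P.1.scale ≤ k₀ := by
            refine (Int.zpow_le_iff_le_log (b := 2) one_lt_two hR).1 ?_
            simpa [side] using h.2
          have hn : P.1.scale = k₀ - ((k₀ - P.1.scale).toNat : ℤ) := by omega
          refine le_trans ?_ (ENNReal.le_tsum (k₀ - P.1.scale).toNat)
          rw [if_pos h, if_pos ⟨h.1, hn⟩, mul_one]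
          refine ENNReal.ofReal_le_ofReal (le_trans (le_of_eq ?_) (hpow _))
          rw [← hn, side]
        · rw [if_neg h]; exact zero_le
    _ ≤ ∑' n : ℕ, ENNReal.ofReal (R ^ s * t ^ n) * C := by
        rw [ENNReal.tsum_comm]
        refine ENNReal.tsum_le_tsum fun n => ?_
        rw [ENNReal.tsum_mul_left]
        gcongr
        exact hcount _
    _ = _ := by
        simp_rw [ENNReal.ofReal_mul (show 0 ≤ R ^ s by positivity)]
        rw [ENNReal.tsum_mul_right, ENNReal.tsum_mul_left, hgeom, ENNReal.coe_mul]
        change _ = _ * ENNReal.ofReal _ * _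
        ring

end DyadicCube

/-! ### Ancestors of a cube in a uniform domain -/

namespace IsUniformDomainWith

variable {d : ℕ} {ε : ℝ} {W : Set (DyadicCube d)} {Ω : Set (EuclideanSpace ℝ (Fin d))}

/-- The admissible chains, with the long distance replaced by `DyadicCube.centerDist` and `ε` by
the smaller constant `ε / (1 + d)`. -/
theorem exists_chain_centerDist (h : IsUniformDomainWith ε W Ω) {Q S : DyadicCube d}
    (hQ : Q ∈ W) (hS : S ∈ W) : ∃ (m : ℕ) (c : ℕ → DyadicCube d), c 0 = Q ∧ c m = S ∧
      (∀ j ≤ m, c j ∈ W) ∧ (∀ j < m, (c j).Neighbor (c (j + 1))) ∧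
      (∀ j ≤ m, ε / (1 + d) * (c j).side ≤ Q.centerDist S) ∧
      ∃ j₀ ≤ m, (∀ j ≤ j₀, ε / (1 + d) * Q.centerDist (c j) ≤ (c j).side) ∧
        ∀ j, j₀ ≤ j → j ≤ m → ε / (1 + d) * (c j).centerDist S ≤ (c j).side := by
  obtain ⟨m, c, hc⟩ := h.exists_chain Q hQ S hS
  obtain ⟨j₀, hj₀, h1, h2⟩ := hc.central
  have hε := h.eps_pos
  have hconv : ∀ A B : DyadicCube d, ε / (1 + d) * A.centerDist B ≤ ε * longDist A B := by
    intro A B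
    have := A.centerDist_le_longDist B
    rw [div_mul_eq_mul_div, div_le_iff₀ (by positivity)]
    calc ε * A.centerDist B ≤ ε * ((1 + d) * longDist A B) := by gcongr
      _ = _ := by ring
  refine ⟨m, c, hc.first, hc.last, hc.mem, hc.neighbor, fun j hj => ?_, j₀, hj₀,
    fun j hj => (hconv _ _).trans (h1 j hj), fun j hj hj' => (hconv _ _).trans (h2 j hj hj')⟩
  have h3 : (c j).side ≤ 1 / ε * longDist Q S :=
    (Finset.single_le_sum (f := fun j => (c j).side) (fun i _ => (c i).side_pos.le)
      (Finset.mem_range.2 (Nat.lt_succ_of_le hj))).trans hc.length_le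
  have h4 : ε * (c j).side ≤ longDist Q S := by
    calc ε * (c j).side ≤ ε * (1 / ε * longDist Q S) := by gcongr
      _ = _ := by field_simp
  have h5 : ε / (1 + d) ≤ ε := div_le_self hε.le (by simp)
  calc ε / (1 + d) * (c j).side ≤ ε * (c j).side := by
        gcongr
        exact (c j).side_pos.le
    _ ≤ _ := h4.trans (Q.longDist_le_centerDist S)

/-- An ancestor of `Q` is a cube `R` that is large as seen from `Q`, in the sense that `ℓ(R)` is at
least a fixed multiple of `D(Q, R)`. Between the size of a cube `Q ∈ W` and that of a cube `P ∈ W`, up to a factor, every scale is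
attained by an ancestor of `Q`: the sides along the first half of a chain from
`Q` to `P` change by a factor `2` at most from one cube to the next. -/
theorem exists_ancestor (h : IsUniformDomainWith ε W Ω) {Q P : DyadicCube d}
    (hQ : Q ∈ W) (hP : P ∈ W) {k : ℤ} (hk : Q.scale ≤ k)
    (hkP : (2 : ℝ) ^ k ≤ ε / (1 + d) / 2 * P.side) :
    ∃ R ∈ W, R.scale = k ∧ ε / (1 + d) * Q.centerDist R ≤ R.side := by
  obtain ⟨m, c, hc0, hcm, hmem, hnb, -, j₀, hj₀, h1, h2⟩ := h.exists_chain_centerDist hQ hP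
  have hκ : 0 < ε / (1 + d) := div_pos h.eps_pos (by positivity)
  have hstep : ∀ j < m, (c (j + 1)).scale ≤ (c j).scale + 1 := by
    intro j hj
    have := h.whitney.side_le_two_mul (hmem j hj.le) (hmem (j + 1) hj) (hnb j hj)
    unfold DyadicCube.side at this
    rw [← zpow_one_add₀ two_ne_zero] at this
    have := (zpow_le_zpow_iff_right₀ (one_lt_two (α := ℝ))).1 this
    omega
  have htop : k ≤ (c j₀).scale := by
    refine (zpow_le_zpow_iff_right₀ (one_lt_two (α := ℝ))).1 (hkP.trans ?_)
    change _ ≤ (c j₀).side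
    have e1 := h1 j₀ le_rfl
    have e2 := h2 j₀ le_rfl hj₀
    have e3 := mul_le_mul_of_nonneg_left ((Q.side_le_centerDist' P).trans
      (Q.centerDist_triangle (c j₀) P)) hκ.le
    linarith
  have hex : ∃ j, k ≤ (c j).scale := ⟨j₀, htop⟩
  classical
  have hspec := Nat.find_spec hex
  have hle : Nat.find hex ≤ j₀ := Nat.find_min' hex htop
  refine ⟨c (Nat.find hex), hmem _ (hle.trans hj₀), le_antisymm ?_ hspec, h1 _ hle⟩
  rcases Nat.eq_zero_or_pos (Nat.find hex) with h0 | hpos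
  · rw [h0, hc0]; exact hk
  · obtain ⟨j, hj⟩ := Nat.exists_eq_succ_of_ne_zero hpos.ne'
    have e1 := Nat.find_min hex (m := j) (by omega)
    have e2 := hstep j (by omega)
    rw [hj, Nat.succ_eq_add_one]
    omega

open Classical in
/-- The telescoping sum of `ℓ^{-δ}` over the scales between `Q` and `P`, each realised by an
ancestor of `Q`. -/
theorem side_rpow_neg_le (h : IsUniformDomainWith ε W Ω) {n₀ : ℕ}
    (hn₀ : ((2 : ℝ) ^ n₀)⁻¹ ≤ ε / (1 + d) / 2) {δ : ℝ} (hδ : 0 ≤ δ) {Q P : DyadicCube d}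
    (hQ : Q ∈ W) (hP : P ∈ W) :
    ENNReal.ofReal (Q.side ^ (-δ)) ≤
      ENNReal.ofReal (((2 : ℝ) ^ n₀) ^ δ * P.side ^ (-δ)) +
      ENNReal.ofReal (1 - 2 ^ (-δ)) * ∑' R : W,
        if ε / (1 + d) * Q.centerDist R ≤ R.1.side ∧ Q.side ≤ R.1.side ∧ R.1.side ≤ P.side then
          ENNReal.ofReal (R.1.side ^ (-δ)) else 0 := by
  have hP0 := P.side_pos
  have hQ0 := Q.side_pos
  have hκ : 0 < ε / (1 + d) := div_pos h.eps_pos (by positivity)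
  have hzpow : ∀ n : ℤ, (2 : ℝ) ^ (P.scale - n₀ + n) = P.side * ((2 : ℝ) ^ n₀)⁻¹ * 2 ^ n := by
    intro n
    rw [zpow_add₀ two_ne_zero, zpow_sub₀ two_ne_zero, zpow_natCast, div_eq_mul_inv]; rfl
  have hend : ∀ x : ℝ, P.side * ((2 : ℝ) ^ n₀)⁻¹ ≤ x →
      x ^ (-δ) ≤ ((2 : ℝ) ^ n₀) ^ δ * P.side ^ (-δ) := by
    intro x hx
    refine (Real.rpow_le_rpow_of_nonpos (by positivity) hx (by linarith)).trans (le_of_eq ?_)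
    rw [Real.mul_rpow hP0.le (by positivity), Real.inv_rpow (by positivity),
      Real.rpow_neg (by positivity : (0 : ℝ) ≤ 2 ^ n₀), inv_inv, mul_comm]
  rcases lt_or_ge (P.scale - n₀) Q.scale with hlt | hge
  · refine le_add_right (ENNReal.ofReal_le_ofReal (hend _ ?_))
    have := hzpow 0
    rw [add_zero, zpow_zero, mul_one] at this
    rw [← this]
    exact zpow_le_zpow_right₀ one_le_two hlt.le
  obtain ⟨N, hN⟩ := Int.le.dest hge
  have hside : ∀ n : ℕ, (2 : ℝ) ^ (Q.scale + n) = Q.side * 2 ^ n := by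
    intro n; rw [zpow_add₀ two_ne_zero, zpow_natCast]; rfl
  have hNside : Q.side * 2 ^ N = P.side * ((2 : ℝ) ^ n₀)⁻¹ := by
    rw [← hside, hN]; simpa using hzpow 0
  have hanc : ∀ n : Fin N, ∃ R ∈ W, R.scale = Q.scale + (n : ℕ) ∧
      ε / (1 + d) * Q.centerDist R ≤ R.side := by
    intro n
    refine h.exists_ancestor hQ hP (by omega) ?_
    calc (2 : ℝ) ^ (Q.scale + (n : ℕ)) ≤ 2 ^ (Q.scale + N) :=
          zpow_le_zpow_right₀ one_le_two (by have := n.2; omega)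
      _ = ((2 : ℝ) ^ n₀)⁻¹ * P.side := by rw [hside, hNside, mul_comm]
      _ ≤ _ := by gcongr
  choose R hRW hRs hRa using hanc
  have hRside : ∀ n : Fin N, (R n).side = Q.side * 2 ^ (n : ℕ) := fun n => by
    rw [← hside, ← hRs]; rfl
  have hR1 : ∀ n : Fin N, Q.side ≤ (R n).side := fun n => by
    rw [hRside]; exact le_mul_of_one_le_right hQ0.le (one_le_pow₀ one_le_two)
  have hR2 : ∀ n : Fin N, (R n).side ≤ P.side := fun n => by
    refine zpow_le_zpow_right₀ one_le_two ?_
    rw [hRs]; have := n.2; omega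
  -- the telescoping sum
  have htel : Q.side ^ (-δ) = (Q.side * 2 ^ N) ^ (-δ)
      + (1 - 2 ^ (-δ)) * ∑ n : Fin N, (R n).side ^ (-δ) := by
    have h1 := Finset.sum_range_sub' (fun n : ℕ => (Q.side * (2 : ℝ) ^ n) ^ (-δ)) N
    have h2 : ∀ n : ℕ, (Q.side * (2 : ℝ) ^ n) ^ (-δ) - (Q.side * (2 : ℝ) ^ (n + 1)) ^ (-δ)
        = (1 - 2 ^ (-δ)) * (Q.side * (2 : ℝ) ^ n) ^ (-δ) := by
      intro n
      rw [pow_succ, ← mul_assoc, Real.mul_rpow (by positivity) two_pos.le]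
      ring
    simp_rw [h2, ← Finset.mul_sum] at h1
    simp_rw [hRside]
    rw [Fin.sum_univ_eq_sum_range (fun n => (Q.side * (2 : ℝ) ^ n) ^ (-δ)) N, h1]
    simp
  have h2δ : (0 : ℝ) ≤ 1 - 2 ^ (-δ) := by
    rw [sub_nonneg]; exact Real.rpow_le_one_of_one_le_of_nonpos one_le_two (by linarith)
  rw [htel, ENNReal.ofReal_add (by positivity) (mul_nonneg h2δ (Finset.sum_nonneg fun n _ =>
    Real.rpow_nonneg (R n).side_pos.le _)), ENNReal.ofReal_mul h2δ]
  gcongr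
  · exact hend _ hNside.ge
  · rw [ENNReal.ofReal_sum_of_nonneg fun n _ => Real.rpow_nonneg (R n).side_pos.le _]
    have hinj : Function.Injective fun n : Fin N => (⟨R n, hRW n⟩ : W) := by
      intro n n' hnn
      have h3 : R n = R n' := congrArg Subtype.val hnn
      have h4 := hRs n
      rw [h3, hRs n'] at h4
      exact Fin.ext (by omega)
    refine le_trans (le_of_eq ?_) (ENNReal.tsum_comp_le_tsum_of_injective hinj _)
    rw [tsum_fintype]
    exact Finset.sum_congr rfl fun n _ => (if_pos ⟨hRa n, hR1 n, hR2 n⟩).symm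

end IsUniformDomainWith

/-! ### The kernel `(ℓ(P) / D(Q, P))^{d+s}` -/

namespace DyadicCube

variable {d : ℕ}

/-- The kernel `(ℓ(P) / D(Q, P))^{d+s}`. -/
noncomputable def kernel (s : ℝ) (Q P : DyadicCube d) : ℝ :=
  (P.side / Q.centerDist P) ^ (d + s)

theorem kernel_pos (s : ℝ) (Q P : DyadicCube d) : 0 < kernel s Q P :=
  Real.rpow_pos_of_pos (div_pos P.side_pos (Q.centerDist_pos P)) _

theorem kernel_eq (s : ℝ) (Q P : DyadicCube d) :
    kernel s Q P = P.side ^ (d + s) * Q.centerDist P ^ (-(d + s)) := by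
  rw [kernel, Real.div_rpow P.side_pos.le (Q.centerDist_pos P).le,
    Real.rpow_neg (Q.centerDist_pos P).le, div_eq_mul_inv]

/-- Passing from `Q` to an ancestor `R` of `Q` not larger than `P` decreases the kernel by a
bounded factor at most. -/
theorem kernel_le_of_ancestor {κ s : ℝ} (hκ : 0 < κ) (hs : 0 < s) {Q R P : DyadicCube d}
    (hR : κ * Q.centerDist R ≤ R.side) (hRP : R.side ≤ P.side) :
    kernel s Q P ≤ (1 + 1 / κ) ^ (d + s) * kernel s R P := by
  have hQP := Q.centerDist_pos P
  have hRP0 := R.centerDist_pos P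
  have hP := P.side_pos
  unfold kernel
  rw [← Real.mul_rpow (by positivity) (by positivity)]
  refine Real.rpow_le_rpow (by positivity) ?_ (by positivity)
  have h1 : R.centerDist P ≤ (1 + 1 / κ) * Q.centerDist P := by
    have e1 := R.centerDist_triangle Q P
    have e2 : R.centerDist Q ≤ 1 / κ * Q.centerDist P := by
      rw [one_div, inv_mul_eq_div, le_div_iff₀' hκ, centerDist_comm]
      exact hR.trans (hRP.trans (Q.side_le_centerDist' P))
    linarith
  rw [← mul_div_assoc, div_le_div_iff₀ hQP hRP0]
  calc P.side * R.centerDist P ≤ P.side * ((1 + 1 / κ) * Q.centerDist P) := by gcongr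
    _ = _ := by ring

theorem exists_tsum_side_mul_kernel_le (d : ℕ) {s : ℝ} (hs : 0 < s) :
    ∃ C : ℝ≥0, ∀ (W : Set (DyadicCube d)), W.PairwiseDisjoint toSet → ∀ P : DyadicCube d,
      ∑' Q : W, ENNReal.ofReal (Q.1.side ^ (d : ℝ) * kernel s Q P)
        ≤ C * ENNReal.ofReal (P.side ^ (d : ℝ)) := by
  obtain ⟨C, hC⟩ := exists_tsum_tail_le d hs
  refine ⟨C, fun W hW P => ?_⟩
  have hP := P.side_pos
  calc ∑' Q : W, ENNReal.ofReal (Q.1.side ^ (d : ℝ) * kernel s Q P)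
      = ENNReal.ofReal (P.side ^ (d + s)) * ∑' Q : W, if P.side ≤ P.centerDist Q then
          ENNReal.ofReal (Q.1.side ^ (d : ℝ) * P.centerDist Q ^ (-(d + s))) else 0 := by
        rw [← ENNReal.tsum_mul_left]
        congr 1; ext Q
        rw [if_pos (side_le_centerDist _ _), ← ENNReal.ofReal_mul (by positivity), kernel_eq,
          centerDist_comm]
        congr 1; ring
    _ ≤ ENNReal.ofReal (P.side ^ (d + s)) * (C * ENNReal.ofReal (P.side ^ (-s))) := by
        gcongr
        exact hC W hW P _ hP
    _ = _ := by
        rw [mul_left_comm, ← ENNReal.ofReal_mul (by positivity), ← Real.rpow_add hP]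
        congr 3; ring

/-- The condition of the Schur test for the sums over the second variable of the kernel; it only
uses the disjointness of the cubes. -/
theorem exists_tsum_kernel_mul_side_rpow_neg_le (d : ℕ) {s δ : ℝ} (hδ : 0 < δ) (hδs : δ ≤ s) :
    ∃ C : ℝ≥0, ∀ (W : Set (DyadicCube d)), W.PairwiseDisjoint toSet → ∀ Q : DyadicCube d,
      ∑' P : W, ENNReal.ofReal (kernel s Q P) * ENNReal.ofReal (P.1.side ^ (-δ))
        ≤ C * ENNReal.ofReal (Q.side ^ (-δ)) := by
  obtain ⟨C, hC⟩ := exists_tsum_tail_le d hδ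
  refine ⟨C, fun W hW Q => le_trans (ENNReal.tsum_le_tsum fun P => ?_) (hC W hW Q _ Q.side_pos)⟩
  have hP := P.1.side_pos
  have hD := Q.centerDist_pos P
  rw [if_pos (side_le_centerDist _ _), ← ENNReal.ofReal_mul (kernel_pos _ _ _).le, kernel_eq]
  refine ENNReal.ofReal_le_ofReal ?_
  calc P.1.side ^ (d + s) * Q.centerDist P ^ (-(d + s)) * P.1.side ^ (-δ)
      = P.1.side ^ (d : ℝ) * P.1.side ^ (s - δ) * Q.centerDist P ^ (-(d + s)) := by
        rw [mul_right_comm, ← Real.rpow_add hP, ← Real.rpow_add hP]; congr 2; ring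
    _ ≤ P.1.side ^ (d : ℝ) * Q.centerDist P ^ (s - δ) * Q.centerDist P ^ (-(d + s)) := by
        gcongr
        exact side_le_centerDist' _ _
    _ = _ := by
        rw [mul_assoc, ← Real.rpow_add hD]; congr 2; ring

end DyadicCube

theorem ENNReal.le_two_mul_of_le_add_half {G A : ℝ≥0∞} (hG : G ≠ ∞) (h : G ≤ A + 2⁻¹ * G) :
    G ≤ 2 * A := by
  have h1 : 2⁻¹ * G + 2⁻¹ * G = G := by
    rw [← add_mul, ENNReal.inv_two_add_inv_two, one_mul]
  have h2 : 2⁻¹ * G ≤ A := by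
    have h3 : 2⁻¹ * G + 2⁻¹ * G ≤ A + 2⁻¹ * G := by rwa [h1]
    exact (ENNReal.add_le_add_iff_right (ENNReal.mul_ne_top (by simp) hG)).1 h3
  calc G = 2 * (2⁻¹ * G) := by
        rw [← mul_assoc, ENNReal.mul_inv_cancel two_ne_zero ENNReal.ofNat_ne_top, one_mul]
    _ ≤ 2 * A := by gcongr

namespace IsUniformDomainWith

open DyadicCube

variable {d : ℕ}

open Classical in
/-- The boundary of a uniform domain is porous: the sum of `ℓ(Q)^{d-δ}` over the cubes `Q` near `P`
is still bounded by `ℓ(P)^{d-δ}` for small `δ > 0`. Here the sum is truncated to `ℓ(Q) ≥ τ`.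
Bounding `ℓ(Q)^{-δ}` by a sum over the ancestors of `Q` reproduces the same sum with a factor
`O(δ)`, which is absorbed. -/
theorem exists_truncated_tsum_le (d : ℕ) {s ε : ℝ} (hs : 0 < s) (hε : 0 < ε) :
    ∃ δ₀ : ℝ, 0 < δ₀ ∧ ∃ C : ℝ≥0, ∀ (Ω : Set (EuclideanSpace ℝ (Fin d)))
      (W : Set (DyadicCube d)), IsUniformDomainWith ε W Ω →
      ∀ δ, 0 ≤ δ → δ ≤ δ₀ → ∀ τ, 0 < τ → ∀ P ∈ W,
      (∑' Q : W, if τ ≤ Q.1.side ∧ Q.1.side ≤ P.side then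
        ENNReal.ofReal (Q.1.side ^ (d : ℝ) * Q.1.side ^ (-δ) * kernel s Q P) else 0)
        ≤ C * ENNReal.ofReal (P.side ^ (d : ℝ) * P.side ^ (-δ)) := by
  set κ : ℝ := ε / (1 + d) with hκdef
  have hκ : 0 < κ := div_pos hε (by positivity)
  obtain ⟨C₀, hC₀⟩ := exists_tsum_side_mul_kernel_le d hs
  obtain ⟨C₂, hC₂⟩ := exists_tsum_packing_le d hκ
  obtain ⟨n₀, hn₀⟩ : ∃ n₀ : ℕ, ((2 : ℝ) ^ n₀)⁻¹ ≤ κ / 2 := by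
    obtain ⟨n, hn⟩ := exists_pow_lt_of_lt_one (show 0 < κ / 2 by positivity)
      (show (2 : ℝ)⁻¹ < 1 by norm_num)
    exact ⟨n, by rw [← inv_pow]; exact hn.le⟩
  set C₁ : ℝ := (1 + 1 / κ) ^ (d + s) with hC₁
  have hC₁0 : 0 < C₁ := by positivity
  refine ⟨1 / (2 * C₁ * C₂ + 1), by positivity, 2 * ((2 ^ n₀) * C₀), ?_⟩
  intro Ω W h δ hδ hδ₀ τ hτ P hP
  have hP0 := P.side_pos
  have hdisj := h.whitney.disjoint
  have hδ1 : δ ≤ 1 := hδ₀.trans (by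
    rw [div_le_one (by positivity)]; linarith [show 0 ≤ 2 * C₁ * C₂ by positivity])
  set G := ∑' Q : W, if τ ≤ Q.1.side ∧ Q.1.side ≤ P.side then
        ENNReal.ofReal (Q.1.side ^ (d : ℝ) * Q.1.side ^ (-δ) * kernel s Q P) else 0 with hG
  have hGtop : G ≠ ∞ := by
    have hle : G ≤ ENNReal.ofReal (τ ^ (-δ)) * (C₀ * ENNReal.ofReal (P.side ^ (d : ℝ))) := by
      refine le_trans ?_ (mul_le_mul_right (hC₀ W hdisj P) _)
      rw [← ENNReal.tsum_mul_left]
      refine ENNReal.tsum_le_tsum fun Q => ?_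
      split_ifs with hQ
      · rw [← ENNReal.ofReal_mul (by positivity)]
        refine ENNReal.ofReal_le_ofReal ?_
        have hQ0 := Q.1.side_pos
        have := Real.rpow_le_rpow_of_nonpos hτ hQ.1 (show -δ ≤ 0 by linarith)
        have hk := kernel_pos s Q.1 P
        calc Q.1.side ^ (d : ℝ) * Q.1.side ^ (-δ) * kernel s Q P
            ≤ Q.1.side ^ (d : ℝ) * τ ^ (-δ) * kernel s Q P := by gcongr
          _ = _ := by ring
      · exact zero_le
    exact ne_top_of_le_ne_top (ENNReal.mul_ne_top ENNReal.ofReal_ne_top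
      (ENNReal.mul_ne_top ENNReal.coe_ne_top ENNReal.ofReal_ne_top)) hle
  have h2δ : (0 : ℝ) ≤ 1 - 2 ^ (-δ) := by
    rw [sub_nonneg]; exact Real.rpow_le_one_of_one_le_of_nonpos one_le_two (by linarith)
  have hθ : ENNReal.ofReal (1 - 2 ^ (-δ)) * (ENNReal.ofReal C₁ * C₂) ≤ 2⁻¹ := by
    have e1 : (1 : ℝ) - 2 ^ (-δ) ≤ δ := by
      have := Real.add_one_le_exp (Real.log 2 * -δ)
      rw [Real.rpow_def_of_pos two_pos]
      nlinarith [Real.log_two_lt_d9]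
    have e2 : δ * (C₁ * C₂) ≤ 2⁻¹ := by
      calc δ * (C₁ * C₂) ≤ 1 / (2 * C₁ * C₂ + 1) * (C₁ * C₂) := by gcongr
        _ ≤ 2⁻¹ := by
          rw [div_mul_eq_mul_div, div_le_iff₀ (by positivity)]
          linarith
    rw [← ENNReal.ofReal_coe_nnreal, ← ENNReal.ofReal_mul hC₁0.le, ← ENNReal.ofReal_mul h2δ]
    have e3 : (2⁻¹ : ℝ≥0∞) = ENNReal.ofReal 2⁻¹ := by
      rw [ENNReal.ofReal_inv_of_pos two_pos]; simp
    rw [e3]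
    refine ENNReal.ofReal_le_ofReal (le_trans ?_ e2)
    gcongr
  -- the contribution of the ancestors of `Q`, with the order of summation exchanged
  have hanc : ∑' Q : W, (if τ ≤ Q.1.side ∧ Q.1.side ≤ P.side then
        ENNReal.ofReal (Q.1.side ^ (d : ℝ) * kernel s Q P) * ∑' R : W,
        (if κ * Q.1.centerDist R ≤ R.1.side ∧ Q.1.side ≤ R.1.side ∧ R.1.side ≤ P.side then
          ENNReal.ofReal (R.1.side ^ (-δ)) else 0) else 0) ≤ ENNReal.ofReal C₁ * C₂ * G := by
    calc _ ≤ ∑' Q : W, ∑' R : W, (if τ ≤ R.1.side ∧ R.1.side ≤ P.side then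
          ENNReal.ofReal (C₁ * kernel s R P * R.1.side ^ (-δ)) else 0) *
          (if κ * R.1.centerDist Q ≤ R.1.side then ENNReal.ofReal (Q.1.side ^ (d : ℝ)) else 0) := by
          refine ENNReal.tsum_le_tsum fun Q => ?_
          split_ifs with hQ
          · rw [← ENNReal.tsum_mul_left]
            refine ENNReal.tsum_le_tsum fun R => ?_
            by_cases hR : κ * Q.1.centerDist R ≤ R.1.side ∧ Q.1.side ≤ R.1.side ∧
              R.1.side ≤ P.side
            · have hQ0 := Q.1.side_pos
              have hR0 := R.1.side_pos
              have hk := kernel_pos s R.1 P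
              have hk' := kernel_pos s Q.1 P
              rw [if_pos hR, if_pos ⟨hQ.1.trans hR.2.1, hR.2.2⟩,
                if_pos (by rw [centerDist_comm]; exact hR.1),
                ← ENNReal.ofReal_mul (by positivity), ← ENNReal.ofReal_mul (by positivity)]
              refine ENNReal.ofReal_le_ofReal ?_
              calc Q.1.side ^ (d : ℝ) * kernel s Q P * R.1.side ^ (-δ)
                  ≤ Q.1.side ^ (d : ℝ) * (C₁ * kernel s R P) * R.1.side ^ (-δ) := by
                    gcongr
                    exact kernel_le_of_ancestor hκ hs hR.1 hR.2.2
                _ = _ := by ring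
            · rw [if_neg hR, mul_zero]; exact zero_le
          · exact zero_le
      _ ≤ ∑' R : W, (if τ ≤ R.1.side ∧ R.1.side ≤ P.side then
          ENNReal.ofReal (C₁ * kernel s R P * R.1.side ^ (-δ)) else 0) *
          (C₂ * ENNReal.ofReal (R.1.side ^ (d : ℝ))) := by
          rw [ENNReal.tsum_comm]
          refine ENNReal.tsum_le_tsum fun R => ?_
          rw [ENNReal.tsum_mul_left]
          gcongr
          exact hC₂ W hdisj R _ R.1.side_pos
      _ = _ := by
          rw [hG, ← ENNReal.tsum_mul_left]
          congr 1; ext R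
          split_ifs with hR
          · have hR0 := R.1.side_pos
            have hk := kernel_pos s R.1 P
            have e : ENNReal.ofReal (R.1.side ^ (d : ℝ) * R.1.side ^ (-δ) * kernel s R P)
              = ENNReal.ofReal (kernel s R P * R.1.side ^ (-δ)) *
                ENNReal.ofReal (R.1.side ^ (d : ℝ)) := by
              rw [← ENNReal.ofReal_mul (by positivity)]; congr 1; ring
            rw [e, mul_assoc C₁, ENNReal.ofReal_mul hC₁0.le]
            ring
          · simp
  have hmain : G ≤ ENNReal.ofReal (((2 : ℝ) ^ n₀) ^ δ * P.side ^ (-δ)) *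
      (C₀ * ENNReal.ofReal (P.side ^ (d : ℝ))) + 2⁻¹ * G := by
    calc G ≤ ∑' Q : W, (ENNReal.ofReal (((2 : ℝ) ^ n₀) ^ δ * P.side ^ (-δ)) *
          ENNReal.ofReal (Q.1.side ^ (d : ℝ) * kernel s Q P) +
          ENNReal.ofReal (1 - 2 ^ (-δ)) * (if τ ≤ Q.1.side ∧ Q.1.side ≤ P.side then
        ENNReal.ofReal (Q.1.side ^ (d : ℝ) * kernel s Q P) * ∑' R : W,
        (if κ * Q.1.centerDist R ≤ R.1.side ∧ Q.1.side ≤ R.1.side ∧ R.1.side ≤ P.side then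
          ENNReal.ofReal (R.1.side ^ (-δ)) else 0) else 0)) := by
          refine ENNReal.tsum_le_tsum fun Q => ?_
          split_ifs with hQ
          · have hQ0 := Q.1.side_pos
            have hk := kernel_pos s Q.1 P
            have e : ENNReal.ofReal (Q.1.side ^ (d : ℝ) * Q.1.side ^ (-δ) * kernel s Q P)
              = ENNReal.ofReal (Q.1.side ^ (d : ℝ) * kernel s Q P) *
                ENNReal.ofReal (Q.1.side ^ (-δ)) := by
              rw [← ENNReal.ofReal_mul (by positivity)]; congr 1; ring
            rw [e]
            refine (mul_le_mul_right (h.side_rpow_neg_le hn₀ hδ Q.2 hP) _).trans (le_of_eq ?_)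
            rw [mul_add, mul_comm (ENNReal.ofReal (Q.1.side ^ (d : ℝ) * kernel s Q P)),
              mul_left_comm]
          · exact zero_le
      _ = ENNReal.ofReal (((2 : ℝ) ^ n₀) ^ δ * P.side ^ (-δ)) *
          ∑' Q : W, ENNReal.ofReal (Q.1.side ^ (d : ℝ) * kernel s Q P) +
          ENNReal.ofReal (1 - 2 ^ (-δ)) * ∑' Q : W, (if τ ≤ Q.1.side ∧ Q.1.side ≤ P.side then
        ENNReal.ofReal (Q.1.side ^ (d : ℝ) * kernel s Q P) * ∑' R : W,
        (if κ * Q.1.centerDist R ≤ R.1.side ∧ Q.1.side ≤ R.1.side ∧ R.1.side ≤ P.side then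
          ENNReal.ofReal (R.1.side ^ (-δ)) else 0) else 0) := by
          rw [ENNReal.tsum_add, ENNReal.tsum_mul_left, ENNReal.tsum_mul_left]
      _ ≤ ENNReal.ofReal (((2 : ℝ) ^ n₀) ^ δ * P.side ^ (-δ)) *
          (C₀ * ENNReal.ofReal (P.side ^ (d : ℝ))) +
          ENNReal.ofReal (1 - 2 ^ (-δ)) * (ENNReal.ofReal C₁ * C₂ * G) := by
          gcongr
          exact hC₀ W hdisj P
      _ ≤ _ := by
          rw [← mul_assoc (ENNReal.ofReal (1 - 2 ^ (-δ)))]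
          gcongr
  refine (ENNReal.le_two_mul_of_le_add_half hGtop hmain).trans ?_
  have hpow : ((2 : ℝ) ^ n₀) ^ δ ≤ 2 ^ n₀ := by
    calc ((2 : ℝ) ^ n₀) ^ δ ≤ ((2 : ℝ) ^ n₀) ^ (1 : ℝ) :=
          Real.rpow_le_rpow_of_exponent_le (one_le_pow₀ one_le_two) hδ1
      _ = _ := Real.rpow_one _
  calc 2 * (ENNReal.ofReal (((2 : ℝ) ^ n₀) ^ δ * P.side ^ (-δ)) *
        (C₀ * ENNReal.ofReal (P.side ^ (d : ℝ))))
      ≤ 2 * (ENNReal.ofReal ((2 : ℝ) ^ n₀ * P.side ^ (-δ)) *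
        (C₀ * ENNReal.ofReal (P.side ^ (d : ℝ)))) := by gcongr
    _ = _ := by
        rw [ENNReal.ofReal_mul (by positivity), ENNReal.ofReal_mul (by positivity),
          ENNReal.ofReal_pow two_pos.le]
        push_cast
        simp only [ENNReal.ofReal_ofNat]
        ring

/-- The condition of the Schur test for the sums over the first variable of the kernel. -/
theorem exists_tsum_side_rpow_mul_kernel_le (d : ℕ) {s ε : ℝ} (hs : 0 < s) (hε : 0 < ε) :
    ∃ δ₀ : ℝ, 0 < δ₀ ∧ ∃ C : ℝ≥0, ∀ (Ω : Set (EuclideanSpace ℝ (Fin d)))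
      (W : Set (DyadicCube d)), IsUniformDomainWith ε W Ω →
      ∀ δ, 0 ≤ δ → δ ≤ δ₀ → ∀ P ∈ W,
      ∑' Q : W, ENNReal.ofReal (Q.1.side ^ (d : ℝ) * Q.1.side ^ (-δ) * kernel s Q P)
        ≤ C * ENNReal.ofReal (P.side ^ (d : ℝ) * P.side ^ (-δ)) := by
  classical
  obtain ⟨δ₀, hδ₀, C, hC⟩ := exists_truncated_tsum_le d hs hε
  obtain ⟨C₀, hC₀⟩ := exists_tsum_side_mul_kernel_le d hs
  refine ⟨δ₀, hδ₀, C + C₀, fun Ω W h δ hδ hδ' P hP => ?_⟩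
  have hP0 := P.side_pos
  rw [ENNReal.tsum_eq_iSup_sum]
  refine iSup_le fun F => ?_
  obtain ⟨τ, hτ, hF⟩ : ∃ τ : ℝ, 0 < τ ∧ ∀ Q ∈ F, τ ≤ Q.1.side := by
    induction F using Finset.induction with
    | empty => exact ⟨1, one_pos, by simp⟩
    | insert Q F _ ih =>
      obtain ⟨τ, hτ, hF⟩ := ih
      refine ⟨min τ Q.1.side, lt_min hτ Q.1.side_pos, fun R hR => ?_⟩
      rcases Finset.mem_insert.1 hR with rfl | hR
      · exact min_le_right _ _
      · exact (min_le_left _ _).trans (hF R hR)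
  calc ∑ Q ∈ F, ENNReal.ofReal (Q.1.side ^ (d : ℝ) * Q.1.side ^ (-δ) * kernel s Q P)
      ≤ ∑ Q ∈ F, ((if τ ≤ Q.1.side ∧ Q.1.side ≤ P.side then
          ENNReal.ofReal (Q.1.side ^ (d : ℝ) * Q.1.side ^ (-δ) * kernel s Q P) else 0) +
          ENNReal.ofReal (P.side ^ (-δ)) *
            ENNReal.ofReal (Q.1.side ^ (d : ℝ) * kernel s Q P)) := by
        refine Finset.sum_le_sum fun Q hQ => ?_
        by_cases hle : Q.1.side ≤ P.side
        · rw [if_pos ⟨hF Q hQ, hle⟩]; exact le_self_add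
        · rw [if_neg (fun hc => hle hc.2), zero_add, ← ENNReal.ofReal_mul (by positivity)]
          refine ENNReal.ofReal_le_ofReal ?_
          have hQ0 := Q.1.side_pos
          have hk := kernel_pos s Q.1 P
          have := Real.rpow_le_rpow_of_nonpos hP0 (not_le.1 hle).le (show -δ ≤ 0 by linarith)
          calc Q.1.side ^ (d : ℝ) * Q.1.side ^ (-δ) * kernel s Q P
              ≤ Q.1.side ^ (d : ℝ) * P.side ^ (-δ) * kernel s Q P := by gcongr
            _ = _ := by ring
    _ ≤ ∑' Q : W, ((if τ ≤ Q.1.side ∧ Q.1.side ≤ P.side then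
          ENNReal.ofReal (Q.1.side ^ (d : ℝ) * Q.1.side ^ (-δ) * kernel s Q P) else 0) +
          ENNReal.ofReal (P.side ^ (-δ)) *
            ENNReal.ofReal (Q.1.side ^ (d : ℝ) * kernel s Q P)) := ENNReal.sum_le_tsum _
    _ ≤ C * ENNReal.ofReal (P.side ^ (d : ℝ) * P.side ^ (-δ)) +
          ENNReal.ofReal (P.side ^ (-δ)) * (C₀ * ENNReal.ofReal (P.side ^ (d : ℝ))) := by
        rw [ENNReal.tsum_add, ENNReal.tsum_mul_left]
        gcongr
        · exact hC Ω W h δ hδ hδ' τ hτ P hP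
        · exact hC₀ W h.whitney.disjoint P
    _ = _ := by
        rw [mul_left_comm, ← ENNReal.ofReal_mul (by positivity),
          mul_comm (P.side ^ (-δ)), ← add_mul, ENNReal.coe_add]

/-- The operator with kernel `(ℓ(P) / D(Q, P))^{d+s}` is bounded on `ℓ^r` with weights `ℓ^d`. The
Schur test applies with a small negative power of the side length. -/
theorem exists_tsum_kernel_rpow_le (d : ℕ) {s ε r : ℝ} (hs : 0 < s) (hε : 0 < ε) (hr : 1 ≤ r) :
    ∃ C : ℝ≥0, ∀ (Ω : Set (EuclideanSpace ℝ (Fin d)))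
      (W : Set (DyadicCube d)), IsUniformDomainWith ε W Ω → ∀ b : W → ℝ≥0∞,
      ∑' Q : W, ENNReal.ofReal (Q.1.side ^ (d : ℝ)) *
        (∑' P : W, ENNReal.ofReal (kernel s Q.1 P) * b P) ^ r
        ≤ C * ∑' P : W, ENNReal.ofReal (P.1.side ^ (d : ℝ)) * b P ^ r := by
  obtain ⟨δ₀, hδ₀, B, hB⟩ := exists_tsum_side_rpow_mul_kernel_le d hs hε
  have hr0 : 0 < r := by linarith
  set δ := min s (δ₀ / r) with hδdef
  have hδ : 0 < δ := lt_min hs (by positivity)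
  have hδr : δ * (r - 1) ≤ δ₀ := by
    have : δ * r ≤ δ₀ := by rw [← le_div_iff₀ hr0]; exact min_le_right _ _
    linarith
  obtain ⟨A, hA⟩ := exists_tsum_kernel_mul_side_rpow_neg_le d hδ (min_le_left s (δ₀ / r))
  refine ⟨A ^ (r - 1) * B, fun Ω W h b => ?_⟩
  have hu : ∀ P : DyadicCube d, ENNReal.ofReal (P.side ^ (-δ)) ^ (r - 1)
      = ENNReal.ofReal (P.side ^ (-(δ * (r - 1)))) := by
    intro P
    have hP := P.side_pos
    rw [ENNReal.ofReal_rpow_of_pos (by positivity), ← Real.rpow_mul hP.le]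
    congr 2; ring
  rw [ENNReal.coe_mul, ENNReal.coe_rpow_of_nonneg _ (by linarith)]
  refine ENNReal.schur_test hr _ _ (fun P : W => ENNReal.ofReal (P.1.side ^ (-δ)))
    (fun P => ?_) (fun P => ENNReal.ofReal_ne_top) A B (fun Q => ?_) (fun P => ?_) b
  · have hP := P.1.side_pos
    have : 0 < P.1.side ^ (-δ) := by positivity
    simpa using this
  · exact hA W h.whitney.disjoint Q
  · have hP := P.1.side_pos
    rw [hu, ← ENNReal.ofReal_mul (by positivity)]
    refine le_trans (le_of_eq ?_)
      (hB Ω W h (δ * (r - 1)) (mul_nonneg hδ.le (by linarith)) hδr P P.2)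
    congr 1; ext Q
    have hQ := Q.1.side_pos
    rw [hu, ← ENNReal.ofReal_mul (by positivity), ← ENNReal.ofReal_mul (by positivity)]

end IsUniformDomainWith

/-! ### Mean values on cubes -/

theorem edist_integral_rpow_le {α : Type*} [MeasurableSpace α] {ν : Measure α}
    [IsProbabilityMeasure ν] {q : ℝ} (hq : 1 ≤ q) {f : α → ℂ} (hf : Integrable f ν) (v : ℂ) :
    edist v (∫ y, f y ∂ν) ^ q ≤ ∫⁻ y, edist v (f y) ^ q ∂ν := by
  have h1 : v - ∫ y, f y ∂ν = ∫ y, (v - f y) ∂ν := by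
    rw [integral_sub (integrable_const v) hf, integral_const]; simp
  have h2 : edist v (∫ y, f y ∂ν) ≤ ∫⁻ y, edist v (f y) ∂ν := by
    rw [edist_eq_enorm_sub, h1]
    simp_rw [edist_eq_enorm_sub]
    exact enorm_integral_le_lintegral_enorm _
  have h3 : AEMeasurable (fun y => edist v (f y)) ν := by
    simp_rw [edist_eq_enorm_sub]
    exact ((aestronglyMeasurable_const.sub hf.aestronglyMeasurable)).enorm
  calc edist v (∫ y, f y ∂ν) ^ q ≤ (∫⁻ y, edist v (f y) ∂ν) ^ q := by gcongr
    _ ≤ _ := by simpa using ENNReal.rpow_lintegral_le hq h3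

namespace DyadicCube

variable {d : ℕ}

/-- The normalised Lebesgue measure on a cube. -/
noncomputable def avgMeasure (Q : DyadicCube d) : Measure (EuclideanSpace ℝ (Fin d)) :=
  (volume Q.toSet)⁻¹ • volume.restrict Q.toSet

theorem volume_toSet_ne_zero (Q : DyadicCube d) : volume Q.toSet ≠ 0 :=
  (Q.isOpen_toSet.measure_pos volume Q.nonempty_toSet).ne'

theorem volume_toSet_ne_top (Q : DyadicCube d) : volume Q.toSet ≠ ∞ := by
  rw [volume_toSet]; exact ENNReal.ofReal_ne_top

instance (Q : DyadicCube d) : IsProbabilityMeasure Q.avgMeasure :=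
  ⟨by simp [avgMeasure, ENNReal.inv_mul_cancel Q.volume_toSet_ne_zero Q.volume_toSet_ne_top]⟩

theorem lintegral_avgMeasure (Q : DyadicCube d) (g : EuclideanSpace ℝ (Fin d) → ℝ≥0∞) :
    ∫⁻ x, g x ∂Q.avgMeasure = (volume Q.toSet)⁻¹ * ∫⁻ x in Q.toSet, g x := by
  rw [avgMeasure, lintegral_smul_measure, smul_eq_mul]

theorem setLIntegral_eq_volume_mul (Q : DyadicCube d) (g : EuclideanSpace ℝ (Fin d) → ℝ≥0∞) :
    ∫⁻ x in Q.toSet, g x = volume Q.toSet * ∫⁻ x, g x ∂Q.avgMeasure := by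
  rw [lintegral_avgMeasure, ← mul_assoc, ENNReal.mul_inv_cancel Q.volume_toSet_ne_zero
    Q.volume_toSet_ne_top, one_mul]

theorem ae_avgMeasure_mem (Q : DyadicCube d) : ∀ᵐ x ∂Q.avgMeasure, x ∈ Q.toSet :=
  Measure.ae_smul_measure (ae_restrict_mem Q.measurableSet_toSet) _

theorem integrable_avgMeasure {Q : DyadicCube d} {f : EuclideanSpace ℝ (Fin d) → ℂ}
    (hf : IntegrableOn f Q.toSet) : Integrable f Q.avgMeasure :=
  hf.smul_measure (ENNReal.inv_ne_top.2 Q.volume_toSet_ne_zero)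

/-- The mean value of `f` on the cube `Q`. -/
noncomputable def mean (f : EuclideanSpace ℝ (Fin d) → ℂ) (Q : DyadicCube d) : ℂ :=
  ∫ x, f x ∂Q.avgMeasure

/-- The `ℓ^r`-mean, `r = p / q`, over `x ∈ Q` of the inner integral over `5Q ∩ Ω`. -/
noncomputable def localMean (s p q : ℝ) (Ω : Set (EuclideanSpace ℝ (Fin d)))
    (f : EuclideanSpace ℝ (Fin d) → ℂ) (Q : DyadicCube d) : ℝ≥0∞ :=
  (∫⁻ x, diffIntegral s q (Q.dilate 5 ∩ Ω) f x ^ (p / q) ∂Q.avgMeasure) ^ (q / p)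

end DyadicCube

theorem measurable_diffIntegral {d : ℕ} (s q : ℝ) (U : Set (EuclideanSpace ℝ (Fin d)))
    {f : EuclideanSpace ℝ (Fin d) → ℂ} (hf : Measurable f) :
    Measurable (diffIntegral s q U f) := by
  unfold diffIntegral
  have : Measurable fun z : EuclideanSpace ℝ (Fin d) × EuclideanSpace ℝ (Fin d) =>
      ‖f z.1 - f z.2‖ₑ ^ q / edist z.1 z.2 ^ (s * q + d) := by fun_prop
  exact this.lintegral_prod_right'

namespace DyadicCube

variable {d : ℕ}

theorem lintegral_diffIntegral_le_localMean {s p q : ℝ} (hq : 1 ≤ q) (hqp : q ≤ p)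
    (Ω : Set (EuclideanSpace ℝ (Fin d))) {f : EuclideanSpace ℝ (Fin d) → ℂ} (hf : Measurable f)
    (Q : DyadicCube d) :
    ∫⁻ x, diffIntegral s q (Q.dilate 5 ∩ Ω) f x ∂Q.avgMeasure ≤ localMean s p q Ω f Q := by
  have hr : 1 ≤ p / q := by rw [le_div_iff₀ (by linarith)]; linarith
  have h := ENNReal.rpow_lintegral_le (μ := Q.avgMeasure) hr
    (measurable_diffIntegral s q (Q.dilate 5 ∩ Ω) hf).aemeasurable
  rw [measure_univ, ENNReal.one_rpow, one_mul] at h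
  unfold localMean
  rw [← inv_div p q]
  exact (ENNReal.le_rpow_inv_iff (by linarith)).2 h

theorem setLIntegral_eq_localMean {s p q : ℝ} (hq : 1 ≤ q) (hqp : q ≤ p)
    (Ω : Set (EuclideanSpace ℝ (Fin d))) (f : EuclideanSpace ℝ (Fin d) → ℂ) (Q : DyadicCube d) :
    ∫⁻ x in Q.toSet, diffIntegral s q (Q.dilate 5 ∩ Ω) f x ^ (p / q)
      = ENNReal.ofReal (Q.side ^ (d : ℝ)) * localMean s p q Ω f Q ^ (p / q) := by
  rw [setLIntegral_eq_volume_mul, volume_toSet, localMean, ← ENNReal.rpow_mul,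
    div_mul_div_comm, mul_comm q p, div_self (by nlinarith), ENNReal.rpow_one]

theorem enorm_sub_rpow_le {s q : ℝ} (hs : 0 < s) (hq : 1 ≤ q) (f : EuclideanSpace ℝ (Fin d) → ℂ)
    {x y : EuclideanSpace ℝ (Fin d)} {a : ℝ} (ha : 0 ≤ a) (h : dist x y ≤ a) :
    edist (f x) (f y) ^ q ≤ ENNReal.ofReal (a ^ (s * q + d)) *
      (‖f x - f y‖ₑ ^ q / edist x y ^ (s * q + d)) := by
  have hexp : 0 < s * q + d := by positivity
  rcases eq_or_ne x y with rfl | hne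
  · rw [edist_self, ENNReal.zero_rpow_of_pos (by linarith)]; exact zero_le
  · rw [← ENNReal.ofReal_rpow_of_nonneg ha hexp.le]
    have h0 : edist x y ^ (s * q + d) ≠ 0 := by
      simp [ENNReal.rpow_eq_zero_iff, hne, edist_ne_top, hexp]
    have ht : edist x y ^ (s * q + d) ≠ ∞ :=
      ENNReal.rpow_ne_top_of_nonneg hexp.le (edist_ne_top _ _)
    calc edist (f x) (f y) ^ q
        = edist x y ^ (s * q + d) * (‖f x - f y‖ₑ ^ q / edist x y ^ (s * q + d)) := by
          rw [ENNReal.mul_div_cancel h0 ht, edist_eq_enorm_sub]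
      _ ≤ _ := by
          gcongr
          rw [edist_dist]; exact ENNReal.ofReal_le_ofReal h

theorem exists_edist_mean_le (d : ℕ) {s q : ℝ} (hs : 0 < s) (hq : 1 ≤ q) :
    ∃ C : ℝ≥0, ∀ (Ω : Set (EuclideanSpace ℝ (Fin d))) (f : EuclideanSpace ℝ (Fin d) → ℂ)
      (Q P : DyadicCube d), IntegrableOn f P.toSet → P.toSet ⊆ Q.dilate 5 ∩ Ω →
      Q.side ≤ 2 * P.side → ∀ x ∈ Q.toSet,
      edist (f x) (mean f P) ^ q ≤
        C * ENNReal.ofReal (Q.side ^ (s * q)) * diffIntegral s q (Q.dilate 5 ∩ Ω) f x := by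
  refine ⟨((2 : ℝ) ^ (d : ℝ) * (d * 3) ^ (s * q + d)).toNNReal,
    fun Ω f Q P hfP hsub hside x hx => ?_⟩
  have hQ := Q.side_pos
  have hP := P.side_pos
  have hdist : ∀ y ∈ P.toSet, dist x y ≤ d * (3 * Q.side) := by
    intro y hy
    refine EuclideanSpace.dist_le_card_mul (by positivity) fun i => ?_
    have h1 := (Q.mem_toSet_iff x).1 hx i
    have h2 : |y i - Q.center i| < 5 * Q.side / 2 := (hsub hy).1 i
    have h3 := abs_sub_le (x i) (Q.center i) (y i)
    rw [abs_sub_comm (Q.center i)] at h3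
    linarith
  have h1 : ∫⁻ y in P.toSet, edist (f x) (f y) ^ q
      ≤ ENNReal.ofReal ((d * (3 * Q.side)) ^ (s * q + d)) *
        diffIntegral s q (Q.dilate 5 ∩ Ω) f x := by
    calc ∫⁻ y in P.toSet, edist (f x) (f y) ^ q
        ≤ ∫⁻ y in P.toSet, ENNReal.ofReal ((d * (3 * Q.side)) ^ (s * q + d)) *
          (‖f x - f y‖ₑ ^ q / edist x y ^ (s * q + d)) :=
          setLIntegral_mono' P.measurableSet_toSet fun y hy =>
            enorm_sub_rpow_le hs hq f (by positivity) (hdist y hy)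
      _ = ENNReal.ofReal ((d * (3 * Q.side)) ^ (s * q + d)) *
          ∫⁻ y in P.toSet, ‖f x - f y‖ₑ ^ q / edist x y ^ (s * q + d) :=
          lintegral_const_mul' _ _ ENNReal.ofReal_ne_top
      _ ≤ _ := by
          gcongr
          exact lintegral_mono_set hsub
  have h2 : (volume P.toSet)⁻¹ ≤ ENNReal.ofReal (2 ^ (d : ℝ) * Q.side ^ (-(d : ℝ))) := by
    rw [volume_toSet, ← ENNReal.ofReal_inv_of_pos (by positivity)]
    refine ENNReal.ofReal_le_ofReal ?_
    rw [Real.rpow_neg hQ.le, ← div_eq_mul_inv, ← Real.div_rpow two_pos.le hQ.le,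
      ← Real.inv_rpow hP.le]
    refine Real.rpow_le_rpow (by positivity) ?_ (by positivity)
    rw [inv_eq_one_div, div_le_div_iff₀ hP hQ]
    linarith
  calc edist (f x) (mean f P) ^ q ≤ ∫⁻ y, edist (f x) (f y) ^ q ∂P.avgMeasure :=
        edist_integral_rpow_le hq (integrable_avgMeasure hfP) _
    _ ≤ ENNReal.ofReal (2 ^ (d : ℝ) * Q.side ^ (-(d : ℝ))) *
        (ENNReal.ofReal ((d * (3 * Q.side)) ^ (s * q + d)) *
          diffIntegral s q (Q.dilate 5 ∩ Ω) f x) := by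
        rw [lintegral_avgMeasure]
        gcongr
    _ = _ := by
        change _ = ENNReal.ofReal _ * _ * _
        rw [← mul_assoc, ← ENNReal.ofReal_mul (by positivity), ← ENNReal.ofReal_mul (by positivity)]
        congr 2
        rw [← mul_assoc, Real.mul_rpow (by positivity) hQ.le, Real.rpow_add hQ (s * q),
          Real.rpow_neg hQ.le]
        have : Q.side ^ (d : ℝ) ≠ 0 := by positivity
        field_simp

theorem exists_lintegral_edist_mean_le (d : ℕ) {s p q : ℝ} (hs : 0 < s) (hq : 1 ≤ q)
    (hqp : q ≤ p) :
    ∃ C : ℝ≥0, ∀ (Ω : Set (EuclideanSpace ℝ (Fin d))) (f : EuclideanSpace ℝ (Fin d) → ℂ)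
      (Q P : DyadicCube d), Measurable f → IntegrableOn f P.toSet →
      P.toSet ⊆ Q.dilate 5 ∩ Ω → Q.side ≤ 2 * P.side →
      ∫⁻ x, edist (f x) (mean f P) ^ q ∂Q.avgMeasure ≤
        C * ENNReal.ofReal (Q.side ^ (s * q)) * localMean s p q Ω f Q := by
  obtain ⟨C, hC⟩ := exists_edist_mean_le d hs hq
  refine ⟨C, fun Ω f Q P hf hfP hsub hside => ?_⟩
  calc ∫⁻ x, edist (f x) (mean f P) ^ q ∂Q.avgMeasure
      ≤ ∫⁻ x, C * ENNReal.ofReal (Q.side ^ (s * q)) *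
          diffIntegral s q (Q.dilate 5 ∩ Ω) f x ∂Q.avgMeasure :=
        lintegral_mono_ae (Q.ae_avgMeasure_mem.mono fun x hx => hC Ω f Q P hfP hsub hside x hx)
    _ = C * ENNReal.ofReal (Q.side ^ (s * q)) *
          ∫⁻ x, diffIntegral s q (Q.dilate 5 ∩ Ω) f x ∂Q.avgMeasure :=
        lintegral_const_mul _ (measurable_diffIntegral _ _ _ hf)
    _ ≤ _ := by
        gcongr
        exact lintegral_diffIntegral_le_localMean hq hqp Ω hf Q

theorem exists_edist_mean_mean_le (d : ℕ) {s p q : ℝ} (hs : 0 < s) (hq : 1 ≤ q)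
    (hqp : q ≤ p) :
    ∃ C : ℝ≥0, ∀ (Ω : Set (EuclideanSpace ℝ (Fin d))) (f : EuclideanSpace ℝ (Fin d) → ℂ)
      (Q P : DyadicCube d), Measurable f → IntegrableOn f Q.toSet → IntegrableOn f P.toSet →
      P.toSet ⊆ Q.dilate 5 ∩ Ω → Q.side ≤ 2 * P.side →
      edist (mean f Q) (mean f P) ≤
        ENNReal.ofReal (Q.side ^ s) * (C * localMean s p q Ω f Q) ^ (1 / q) := by
  obtain ⟨C, hC⟩ := exists_lintegral_edist_mean_le d hs hq hqp
  refine ⟨C, fun Ω f Q P hf hfQ hfP hsub hside => ?_⟩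
  have hq0 : 0 < q := by linarith
  have hQ := Q.side_pos
  have h1 : edist (mean f Q) (mean f P) ^ q ≤
      C * ENNReal.ofReal (Q.side ^ (s * q)) * localMean s p q Ω f Q := by
    refine le_trans ?_ (hC Ω f Q P hf hfP hsub hside)
    simp_rw [edist_comm _ (mean f P)]
    exact edist_integral_rpow_le hq (integrable_avgMeasure hfQ) _
  have h2 := (ENNReal.le_rpow_inv_iff hq0).2 h1
  refine h2.trans (le_of_eq ?_)
  rw [one_div, mul_comm (C : ℝ≥0∞), mul_assoc, ENNReal.mul_rpow_of_nonneg _ _ (by positivity),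
    Real.rpow_mul hQ.le, ← ENNReal.ofReal_rpow_of_pos (by positivity), ← ENNReal.rpow_mul,
    mul_inv_cancel₀ hq0.ne', ENNReal.rpow_one]

end DyadicCube

/-- A chain may be pruned to visit each of its elements once: the distance between its ends is at
most the sum of the steps over the set of elements visited. -/
theorem edist_le_sum_image {ι X : Type*} [DecidableEq ι] [PseudoEMetricSpace X] (g : ι → X)
    (e : ι → ℝ≥0∞) (m : ℕ) (c : ℕ → ι)
    (h : ∀ j < m, edist (g (c j)) (g (c (j + 1))) ≤ e (c j)) :
    edist (g (c 0)) (g (c m)) ≤ ∑ R ∈ (Finset.range m).image c, e R := by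
  induction m using Nat.strong_induction_on generalizing c with
  | _ m ih =>
    -- the last visit to the starting point
    set k := Nat.findGreatest (fun j => c j = c 0) m with hk
    have hkm : k ≤ m := Nat.findGreatest_le m
    have hck : c k = c 0 := Nat.findGreatest_spec (P := fun j => c j = c 0) (Nat.zero_le m) rfl
    rcases hkm.eq_or_lt with heq | hlt
    · rw [heq] at hck
      rw [hck, edist_self]; exact zero_le
    · have hlast : ∀ j, k < j → j ≤ m → c j ≠ c 0 := fun j hj hjm =>
        Nat.findGreatest_is_greatest hj hjm
      have hrec := ih (m - (k + 1)) (by omega) (fun j => c (k + 1 + j)) (fun j hj =>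
        h (k + 1 + j) (by omega))
      simp only [add_zero] at hrec
      rw [show k + 1 + (m - (k + 1)) = m by omega] at hrec
      set F := (Finset.range (m - (k + 1))).image fun j => c (k + 1 + j) with hF
      have hnot : c k ∉ F := by
        rw [hF, Finset.mem_image]
        rintro ⟨j, hj, hjc⟩
        rw [Finset.mem_range] at hj
        exact hlast (k + 1 + j) (by omega) (by omega) (hjc.trans hck)
      have hsub : insert (c k) F ⊆ (Finset.range m).image c := by
        refine Finset.insert_subset (Finset.mem_image_of_mem c (Finset.mem_range.2 hlt)) ?_
        intro R hR
        obtain ⟨j, hj, rfl⟩ := Finset.mem_image.1 hR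
        rw [Finset.mem_range] at hj
        exact Finset.mem_image_of_mem c (Finset.mem_range.2 (by omega))
      calc edist (g (c 0)) (g (c m))
          ≤ edist (g (c k)) (g (c (k + 1))) + edist (g (c (k + 1))) (g (c m)) := by
            rw [← hck]; exact edist_triangle _ _ _
        _ ≤ e (c k) + ∑ R ∈ F, e R := add_le_add (h k hlt) hrec
        _ = ∑ R ∈ insert (c k) F, e R := (Finset.sum_insert hnot).symm
        _ ≤ _ := Finset.sum_le_sum_of_subset hsub

/-! ### Differences of mean values along chains -/

namespace IsUniformDomainWith

open DyadicCube

variable {d : ℕ}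

open Classical in
/-- The difference of the mean values over `Q` and `S` is controlled by the cubes, of side at most
a multiple of `D(Q, S)`, that are large as seen from `Q` or from `S`. -/
theorem exists_edist_mean_rpow_le (d : ℕ) {s p q ε : ℝ} (hs : 0 < s) (hq : 1 ≤ q) (hqp : q ≤ p)
    (hε : 0 < ε) :
    ∃ C : ℝ≥0, ∀ (Ω : Set (EuclideanSpace ℝ (Fin d))) (W : Set (DyadicCube d)),
      IsUniformDomainWith ε W Ω → ∀ f : EuclideanSpace ℝ (Fin d) → ℂ, Measurable f →
      (∀ Q ∈ W, IntegrableOn f Q.toSet) → ∀ Q ∈ W, ∀ S ∈ W,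
      edist (mean f Q) (mean f S) ^ q ≤
        C * ENNReal.ofReal (Q.centerDist S ^ (s * (q - 1))) * ∑' P : W,
          (if (ε / (1 + d) * Q.centerDist P ≤ P.1.side ∨ ε / (1 + d) * S.centerDist P ≤ P.1.side) ∧
            ε / (1 + d) * P.1.side ≤ Q.centerDist S then ENNReal.ofReal (P.1.side ^ s) else 0) *
          localMean s p q Ω f P := by
  set κ : ℝ := ε / (1 + d) with hκdef
  have hκ : 0 < κ := div_pos hε (by positivity)
  have hq0 : 0 < q := by linarith
  have hq1 : 0 ≤ q - 1 := by linarith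
  obtain ⟨C₁, hC₁⟩ := exists_edist_mean_mean_le d hs hq hqp
  obtain ⟨C₂, hC₂⟩ := exists_tsum_side_rpow_le d hκ hs
  refine ⟨(2 * C₂ * ((1 / κ) ^ s).toNNReal) ^ (q - 1) * C₁, fun Ω W h f hf hfi Q hQ S hS => ?_⟩
  have hD := Q.centerDist_pos S
  obtain ⟨m, c, hc0, hcm, hmem, hnb, hlen, j₀, hj₀, h1, h2⟩ := h.exists_chain_centerDist hQ hS
  set w : W → ℝ≥0∞ := fun P =>
    if (κ * Q.centerDist P ≤ P.1.side ∨ κ * S.centerDist P ≤ P.1.side) ∧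
      κ * P.1.side ≤ Q.centerDist S then ENNReal.ofReal (P.1.side ^ s) else 0 with hw
  have hstep : ∀ j < m, edist (mean f (c j)) (mean f (c (j + 1))) ≤
      ENNReal.ofReal ((c j).side ^ s) * (C₁ * localMean s p q Ω f (c j)) ^ (1 / q) := by
    intro j hj
    have hj1 := hmem j hj.le
    have hj2 := hmem (j + 1) hj
    refine hC₁ Ω f (c j) (c (j + 1)) hf (hfi _ hj1) (hfi _ hj2) ?_
      (h.whitney.side_le_two_mul hj2 hj1 (hnb j hj).symm)
    exact Set.subset_inter (h.whitney.subset_dilate hj1 hj2 (hnb j hj))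
      (h.whitney.toSet_subset hj2)
  have hsum : edist (mean f Q) (mean f S) ≤
      ∑' P : W, w P * (C₁ * localMean s p q Ω f P) ^ (1 / q) := by
    have e1 := edist_le_sum_image (mean f) (fun P : DyadicCube d =>
      ENNReal.ofReal (P.side ^ s) * (C₁ * localMean s p q Ω f P) ^ (1 / q)) m c hstep
    rw [hc0, hcm] at e1
    refine e1.trans ?_
    have hFW : ∀ P ∈ (Finset.range m).image c, P ∈ W := by
      intro P hP
      obtain ⟨j, hj, rfl⟩ := Finset.mem_image.1 hP
      exact hmem j (Finset.mem_range.1 hj).le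
    rw [← Finset.sum_subtype_of_mem _ hFW]
    refine le_trans (Finset.sum_le_sum fun P hP => ?_) (ENNReal.sum_le_tsum _)
    rw [Finset.mem_subtype] at hP
    obtain ⟨j, hj, hjP⟩ := Finset.mem_image.1 hP
    rw [Finset.mem_range] at hj
    have hcond : (κ * Q.centerDist P ≤ P.1.side ∨ κ * S.centerDist P ≤ P.1.side) ∧
        κ * P.1.side ≤ Q.centerDist S := by
      rw [← hjP]
      refine ⟨?_, hlen j hj.le⟩
      rcases le_total j j₀ with hle | hle
      · exact Or.inl (h1 j hle)
      · right; rw [centerDist_comm]; exact h2 j hle hj.le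
    simp only [hw]
    rw [if_pos hcond]
  have hwsum : ∑' P : W, w P ≤
      ((2 * C₂ * ((1 / κ) ^ s).toNNReal : ℝ≥0) : ℝ≥0∞) * ENNReal.ofReal (Q.centerDist S ^ s) := by
    have hR : 0 < 1 / κ * Q.centerDist S := by positivity
    calc ∑' P : W, w P ≤ ∑' P : W,
          ((if κ * Q.centerDist P ≤ P.1.side ∧ P.1.side ≤ 1 / κ * Q.centerDist S then
            ENNReal.ofReal (P.1.side ^ s) else 0) +
          (if κ * S.centerDist P ≤ P.1.side ∧ P.1.side ≤ 1 / κ * Q.centerDist S then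
            ENNReal.ofReal (P.1.side ^ s) else 0)) := by
          refine ENNReal.tsum_le_tsum fun P => ?_
          simp only [hw]
          split_ifs with hP hP1 hP2 hP2
          · exact le_self_add
          · exact le_self_add
          · exact le_add_self
          · exfalso
            have : P.1.side ≤ 1 / κ * Q.centerDist S := by
              rw [one_div, inv_mul_eq_div, le_div_iff₀' hκ]; exact hP.2
            rcases hP.1 with h3 | h3
            · exact hP1 ⟨h3, this⟩
            · exact hP2 ⟨h3, this⟩
          all_goals exact zero_le
      _ ≤ C₂ * ENNReal.ofReal ((1 / κ * Q.centerDist S) ^ s) +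
          C₂ * ENNReal.ofReal ((1 / κ * Q.centerDist S) ^ s) := by
          rw [ENNReal.tsum_add]
          exact add_le_add (hC₂ W h.whitney.disjoint Q _ hR) (hC₂ W h.whitney.disjoint S _ hR)
      _ = _ := by
          rw [Real.mul_rpow (by positivity) hD.le, ENNReal.ofReal_mul (by positivity)]
          push_cast
          change _ = 2 * (C₂ : ℝ≥0∞) * ENNReal.ofReal _ * _
          ring
  calc edist (mean f Q) (mean f S) ^ q
      ≤ (∑' P : W, w P * (C₁ * localMean s p q Ω f P) ^ (1 / q)) ^ q := by gcongr
    _ ≤ (∑' P : W, w P) ^ (q - 1) *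
        ∑' P : W, w P * ((C₁ * localMean s p q Ω f P) ^ (1 / q)) ^ q :=
        ENNReal.rpow_tsum_mul_le hq _ _
    _ = (∑' P : W, w P) ^ (q - 1) * (C₁ * ∑' P : W, w P * localMean s p q Ω f P) := by
        rw [← ENNReal.tsum_mul_left (a := (C₁ : ℝ≥0∞))]
        congr 2; ext P
        rw [← ENNReal.rpow_mul, one_div_mul_cancel hq0.ne', ENNReal.rpow_one, mul_left_comm]
    _ ≤ (((2 * C₂ * ((1 / κ) ^ s).toNNReal : ℝ≥0) : ℝ≥0∞) *
          ENNReal.ofReal (Q.centerDist S ^ s)) ^ (q - 1) *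
          (C₁ * ∑' P : W, w P * localMean s p q Ω f P) := by gcongr
    _ = _ := by
        rw [ENNReal.mul_rpow_of_nonneg _ _ hq1, ENNReal.ofReal_rpow_of_pos (by positivity),
          ← Real.rpow_mul hD.le, ← ENNReal.coe_rpow_of_nonneg _ hq1, ENNReal.coe_mul]
        ring

open Classical in
/-- Summation over `S` of the weights with which `P` enters the chains from `Q` to `S`. -/
theorem exists_tsum_chain_weight_le (d : ℕ) {s κ : ℝ} (hs : 0 < s) (hκ : 0 < κ) :
    ∃ C : ℝ≥0, ∀ W : Set (DyadicCube d), W.PairwiseDisjoint toSet → ∀ Q P : DyadicCube d,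
      ∑' S : W, ENNReal.ofReal (S.1.side ^ (d : ℝ) * Q.centerDist S ^ (-(d + s))) *
        (if (κ * Q.centerDist P ≤ P.side ∨ κ * S.1.centerDist P ≤ P.side) ∧
            κ * P.side ≤ Q.centerDist S then ENNReal.ofReal (P.side ^ s) else 0)
        ≤ C * ENNReal.ofReal (kernel s Q P) := by
  obtain ⟨C₁, hC₁⟩ := exists_tsum_tail_le d hs
  obtain ⟨C₂, hC₂⟩ := exists_tsum_packing_le d hκ
  set A : ℝ := (1 / κ) ^ s * (1 / κ) ^ (d + s) with hA
  set B : ℝ := (1 + 1 / κ * (1 / κ)) ^ (d + s) with hB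
  have hds : 0 < d + s := by positivity
  refine ⟨A.toNNReal * C₁ + B.toNNReal * C₂, fun W hW Q P => ?_⟩
  have hP := P.side_pos
  have hD := Q.centerDist_pos P
  -- `P` is large as seen from `Q`: all cubes `S` far from `Q` contribute
  have hQpart : (∑' S : W, if κ * Q.centerDist P ≤ P.side ∧ κ * P.side ≤ Q.centerDist S then
      ENNReal.ofReal (S.1.side ^ (d : ℝ) * Q.centerDist S ^ (-(d + s))) *
        ENNReal.ofReal (P.side ^ s) else 0)
      ≤ A.toNNReal * C₁ * ENNReal.ofReal (kernel s Q P) := by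
    by_cases hQP : κ * Q.centerDist P ≤ P.side
    · have hk : (1 : ℝ) ≤ (1 / κ) ^ (d + s) * kernel s Q P := by
        unfold kernel
        rw [← Real.mul_rpow (by positivity) (by positivity)]
        refine Real.one_le_rpow ?_ hds.le
        rw [one_div_mul_eq_div, div_div, le_div_iff₀ (by positivity), one_mul, mul_comm]
        exact hQP
      calc _ = ENNReal.ofReal (P.side ^ s) * ∑' S : W, (if κ * P.side ≤ Q.centerDist S then
            ENNReal.ofReal (S.1.side ^ (d : ℝ) * Q.centerDist S ^ (-(d + s))) else 0) := by
            rw [← ENNReal.tsum_mul_left]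
            congr 1; ext S
            simp only [hQP, true_and]
            split_ifs
            · rw [mul_comm]
            · rw [mul_zero]
        _ ≤ ENNReal.ofReal (P.side ^ s) * (C₁ * ENNReal.ofReal ((κ * P.side) ^ (-s))) := by
            gcongr
            exact hC₁ W hW Q _ (by positivity)
        _ = C₁ * ENNReal.ofReal ((1 / κ) ^ s) := by
            rw [mul_left_comm, ← ENNReal.ofReal_mul (by positivity)]
            congr 2
            rw [Real.mul_rpow hκ.le hP.le, Real.rpow_neg hκ.le, Real.rpow_neg hP.le, one_div,
              Real.inv_rpow hκ.le]
            field_simp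
        _ ≤ C₁ * ENNReal.ofReal (A * kernel s Q P) := by
            gcongr
            rw [hA, mul_assoc]
            exact le_mul_of_one_le_right (by positivity) hk
        _ = _ := by
            rw [ENNReal.ofReal_mul (by positivity), ← mul_assoc, mul_comm (C₁ : ℝ≥0∞)]; rfl
    · simp [hQP]
  -- `P` is large as seen from `S`: these `S` are packed into a neighbourhood of `P`
  have hSpart : (∑' S : W, if κ * S.1.centerDist P ≤ P.side ∧ κ * P.side ≤ Q.centerDist S then
      ENNReal.ofReal (S.1.side ^ (d : ℝ) * Q.centerDist S ^ (-(d + s))) *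
        ENNReal.ofReal (P.side ^ s) else 0)
      ≤ B.toNNReal * C₂ * ENNReal.ofReal (kernel s Q P) := by
    calc _ ≤ ∑' S : W, ENNReal.ofReal (B * Q.centerDist P ^ (-(d + s)) * P.side ^ s) *
          (if κ * P.centerDist S ≤ P.side then ENNReal.ofReal (S.1.side ^ (d : ℝ)) else 0) := by
          refine ENNReal.tsum_le_tsum fun S => ?_
          split_ifs with h1 h2 h2
          · have hS := S.1.side_pos
            have hQS := Q.centerDist_pos S
            rw [← ENNReal.ofReal_mul (by positivity), ← ENNReal.ofReal_mul (by positivity)]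
            refine ENNReal.ofReal_le_ofReal ?_
            have h3 : Q.centerDist P ≤ (1 + 1 / κ * (1 / κ)) * Q.centerDist S := by
              have e1 := Q.centerDist_triangle S P
              have e2 : S.1.centerDist P ≤ 1 / κ * P.side := by
                rw [one_div, inv_mul_eq_div, le_div_iff₀' hκ]; exact h1.1
              have e3 : 1 / κ * P.side ≤ 1 / κ * (1 / κ * Q.centerDist S) := by
                gcongr
                rw [one_div, inv_mul_eq_div, le_div_iff₀' hκ]; exact h1.2
              linarith
            have h4 := Real.rpow_le_rpow_of_nonpos hD h3 (show -(d + s) ≤ 0 by linarith)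
            have h5 : Q.centerDist S ^ (-(d + s)) ≤ B * Q.centerDist P ^ (-(d + s)) := by
              calc Q.centerDist S ^ (-(d + s))
                  = B * ((1 + 1 / κ * (1 / κ)) * Q.centerDist S) ^ (-(d + s)) := by
                    rw [hB, Real.mul_rpow (by positivity) hQS.le, ← mul_assoc,
                      ← Real.rpow_add (by positivity), add_neg_cancel, Real.rpow_zero, one_mul]
                _ ≤ _ := by gcongr
            calc S.1.side ^ (d : ℝ) * Q.centerDist S ^ (-(d + s)) * P.side ^ s
                ≤ S.1.side ^ (d : ℝ) * (B * Q.centerDist P ^ (-(d + s))) * P.side ^ s := by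
                  gcongr
              _ = _ := by ring
          · exact absurd (by rw [centerDist_comm]; exact h1.1) h2
          all_goals exact zero_le
      _ ≤ ENNReal.ofReal (B * Q.centerDist P ^ (-(d + s)) * P.side ^ s) *
          (C₂ * ENNReal.ofReal (P.side ^ (d : ℝ))) := by
          rw [ENNReal.tsum_mul_left]
          gcongr
          exact hC₂ W hW P _ hP
      _ = _ := by
          rw [mul_left_comm, ← ENNReal.ofReal_mul (by positivity), mul_assoc B, mul_assoc B,
            ENNReal.ofReal_mul (by positivity), ← mul_assoc, mul_comm (C₂ : ℝ≥0∞), kernel_eq]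
          change ENNReal.ofReal _ * _ * _ = ENNReal.ofReal _ * _ * _
          congr 2
          rw [mul_assoc, ← Real.rpow_add hP, mul_comm, add_comm s]
  refine le_trans (ENNReal.tsum_le_tsum fun S => ?_) ((ENNReal.tsum_add (f := fun S : W =>
    if κ * Q.centerDist P ≤ P.side ∧ κ * P.side ≤ Q.centerDist S then
      ENNReal.ofReal (S.1.side ^ (d : ℝ) * Q.centerDist S ^ (-(d + s))) *
        ENNReal.ofReal (P.side ^ s) else 0)).le.trans ((add_le_add hQpart hSpart).trans ?_))
  · by_cases h1 : κ * Q.centerDist P ≤ P.side <;> by_cases h2 : κ * S.1.centerDist P ≤ P.side <;>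
      by_cases h3 : κ * P.side ≤ Q.centerDist S <;> simp [h1, h2, h3]
  · rw [← add_mul]; push_cast; exact le_rfl

/-- The contribution of the differences of mean values to the seminorm. -/
theorem exists_tsum_edist_mean_le (d : ℕ) {s p q ε : ℝ} (hs : 0 < s) (hq : 1 ≤ q) (hqp : q ≤ p)
    (hε : 0 < ε) :
    ∃ C : ℝ≥0, ∀ (Ω : Set (EuclideanSpace ℝ (Fin d))) (W : Set (DyadicCube d)),
      IsUniformDomainWith ε W Ω → ∀ f : EuclideanSpace ℝ (Fin d) → ℂ, Measurable f →
      (∀ Q ∈ W, IntegrableOn f Q.toSet) → ∀ Q ∈ W,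
      ∑' S : W, ENNReal.ofReal (S.1.side ^ (d : ℝ) * Q.centerDist S ^ (-(d + s * q))) *
        edist (mean f Q) (mean f S) ^ q
        ≤ C * ∑' P : W, ENNReal.ofReal (kernel s Q P) * localMean s p q Ω f P := by
  classical
  obtain ⟨C₁, hC₁⟩ := exists_edist_mean_rpow_le d hs hq hqp hε
  obtain ⟨C₂, hC₂⟩ := exists_tsum_chain_weight_le d hs
    (show 0 < ε / (1 + d) from div_pos hε (by positivity))
  refine ⟨C₁ * C₂, fun Ω W h f hf hfi Q hQ => ?_⟩
  calc _ ≤ ∑' S : W, ∑' P : W, C₁ * localMean s p q Ω f P *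
        (ENNReal.ofReal (S.1.side ^ (d : ℝ) * Q.centerDist S ^ (-(d + s))) *
        (if (ε / (1 + d) * Q.centerDist P ≤ P.1.side ∨
            ε / (1 + d) * S.1.centerDist P ≤ P.1.side) ∧
            ε / (1 + d) * P.1.side ≤ Q.centerDist S then
          ENNReal.ofReal (P.1.side ^ s) else 0)) := by
        refine ENNReal.tsum_le_tsum fun S => ?_
        refine (mul_le_mul_right (hC₁ Ω W h f hf hfi Q hQ S S.2) _).trans (le_of_eq ?_)
        have hS := S.1.side_pos
        have hQS := Q.centerDist_pos S
        have e : ENNReal.ofReal (S.1.side ^ (d : ℝ) * Q.centerDist S ^ (-(d + s))) =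
            ENNReal.ofReal (S.1.side ^ (d : ℝ) * Q.centerDist S ^ (-(d + s * q))) *
            ENNReal.ofReal (Q.centerDist S ^ (s * (q - 1))) := by
          rw [← ENNReal.ofReal_mul (by positivity), mul_assoc, ← Real.rpow_add hQS]
          congr 3; ring
        rw [← mul_assoc, ← ENNReal.tsum_mul_left]
        congr 1; ext P
        rw [e]; ring
    _ = C₁ * ∑' P : W, localMean s p q Ω f P * ∑' S : W,
        (ENNReal.ofReal (S.1.side ^ (d : ℝ) * Q.centerDist S ^ (-(d + s))) *
        (if (ε / (1 + d) * Q.centerDist P ≤ P.1.side ∨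
            ε / (1 + d) * S.1.centerDist P ≤ P.1.side) ∧
            ε / (1 + d) * P.1.side ≤ Q.centerDist S then
          ENNReal.ofReal (P.1.side ^ s) else 0)) := by
        rw [ENNReal.tsum_comm, ← ENNReal.tsum_mul_left]
        congr 1; ext P
        rw [ENNReal.tsum_mul_left, mul_assoc]
    _ ≤ C₁ * ∑' P : W, localMean s p q Ω f P * (C₂ * ENNReal.ofReal (kernel s Q P)) := by
        gcongr with P
        exact hC₂ W h.whitney.disjoint Q P
    _ = _ := by
        rw [ENNReal.coe_mul, mul_assoc, ← ENNReal.tsum_mul_left (a := (C₂ : ℝ≥0∞))]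
        congr 2; ext P; ring

end IsUniformDomainWith

/-! ### Comparison of the seminorms -/

theorem IsWhitneyCovering.lintegral_le_tsum {d : ℕ} {W : Set (DyadicCube d)}
    {Ω : Set (EuclideanSpace ℝ (Fin d))} (hW : IsWhitneyCovering W Ω)
    (B : Set (EuclideanSpace ℝ (Fin d))) (g : EuclideanSpace ℝ (Fin d) → ℝ≥0∞) :
    ∫⁻ x in Ω \ B, g x ≤ ∑' Q : W, ∫⁻ x in Q.1.toSet \ B, g x := by
  have hsub : Ω \ B ⊆ ⋃ Q : W, closure Q.1.toSet \ B := by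
    intro x hx
    rw [← hW.union_eq] at hx
    simp only [Set.mem_sdiff, Set.mem_iUnion] at hx ⊢
    obtain ⟨⟨Q, hQ, hxQ⟩, hxB⟩ := hx
    exact ⟨⟨Q, hQ⟩, hxQ, hxB⟩
  refine (lintegral_mono_set hsub).trans ((lintegral_iUnion_le _ _).trans (le_of_eq ?_))
  congr 1; ext Q
  refine setLIntegral_congr (ae_eq_set.2 ⟨measure_mono_null ?_ Q.1.volume_closure_diff, ?_⟩)
  · exact fun x hx => ⟨hx.1.1, fun h => hx.2 ⟨h, hx.1.2⟩⟩
  · rw [Set.sdiff_eq_empty.2 (Set.sdiff_subset_sdiff_left subset_closure), measure_empty]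

theorem diffIntegral_congr {d : ℕ} {s q : ℝ} {Ω U : Set (EuclideanSpace ℝ (Fin d))}
    {f g : EuclideanSpace ℝ (Fin d) → ℂ} (hfg : f =ᵐ[volume.restrict Ω] g) (hU : U ⊆ Ω)
    {x : EuclideanSpace ℝ (Fin d)} (hx : f x = g x) :
    diffIntegral s q U f x = diffIntegral s q U g x := by
  refine lintegral_congr_ae ?_
  filter_upwards [ae_restrict_of_ae_restrict_of_subset hU hfg] with y hy
  rw [hx, hy]

namespace IsUniformDomainWith

open DyadicCube

variable {d : ℕ}

/-- For `x ∈ Q` and `y ∈ S` with `y` outside `5Q`, the difference `f x - f y` is compared with the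
mean values over `Q` and `S`, and `|x - y|` with `D(Q, S)`. -/
theorem exists_setLIntegral_diff_le (d : ℕ) {s p q ε : ℝ} (hs : 0 < s) (hq : 1 ≤ q)
    (hqp : q ≤ p) (hε : 0 < ε) :
    ∃ C : ℝ≥0, ∀ (Ω : Set (EuclideanSpace ℝ (Fin d))) (W : Set (DyadicCube d)),
      IsUniformDomainWith ε W Ω → ∀ f : EuclideanSpace ℝ (Fin d) → ℂ, Measurable f →
      (∀ Q ∈ W, IntegrableOn f Q.toSet) → ∀ Q ∈ W, ∀ x ∈ Q.toSet,
      ∫⁻ y in Ω \ Q.dilate 5, ‖f x - f y‖ₑ ^ q / edist x y ^ (s * q + d)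
        ≤ C * (diffIntegral s q (Q.dilate 5 ∩ Ω) f x +
          ∑' P : W, ENNReal.ofReal (kernel s Q P) * localMean s p q Ω f P) := by
  classical
  have hsq : 0 < s * q := by positivity
  have hexp : 0 < s * q + d := by positivity
  obtain ⟨C₁, hC₁⟩ := exists_edist_mean_le d hs hq
  obtain ⟨C₂, hC₂⟩ := exists_tsum_tail_le d hsq
  obtain ⟨C₃, hC₃⟩ := exists_tsum_edist_mean_le d hs hq hqp hε
  obtain ⟨C₄, hC₄⟩ := exists_lintegral_edist_mean_le d hs hq hqp
  set B : ℝ≥0 := ((4 * (1 + d) : ℝ) ^ (s * q + d)).toNNReal * 4 ^ (q - 1) with hB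
  refine ⟨B * (C₁ * C₂ + (C₃ + C₄)), fun Ω W h f hf hfi Q hQ x hx => ?_⟩
  set A := diffIntegral s q (Q.dilate 5 ∩ Ω) f x with hA
  set T := ∑' P : W, ENNReal.ofReal (kernel s Q P) * localMean s p q Ω f P with hT
  have hQ0 := Q.side_pos
  have hself : ∀ S ∈ W, S.toSet ⊆ S.dilate 5 ∩ Ω := fun S hS =>
    Set.subset_inter S.toSet_subset_dilate (h.whitney.toSet_subset hS)
  -- the contribution of a single cube
  have hS : ∀ S : W, ∫⁻ y in S.1.toSet \ Q.dilate 5, ‖f x - f y‖ₑ ^ q / edist x y ^ (s * q + d)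
      ≤ B * (ENNReal.ofReal (S.1.side ^ (d : ℝ) * Q.centerDist S ^ (-(d + s * q))) *
          edist (f x) (mean f Q) ^ q +
        ENNReal.ofReal (S.1.side ^ (d : ℝ) * Q.centerDist S ^ (-(d + s * q))) *
          edist (mean f Q) (mean f S) ^ q +
        C₄ * (ENNReal.ofReal (kernel s Q S) * localMean s p q Ω f S)) := by
    intro S
    have hS0 := S.1.side_pos
    have hD := Q.centerDist_pos S
    have hpt : ∀ y ∈ S.1.toSet \ Q.dilate 5, ‖f x - f y‖ₑ ^ q / edist x y ^ (s * q + d) ≤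
        B * ENNReal.ofReal (Q.centerDist S ^ (-(d + s * q))) *
          (edist (f x) (mean f Q) ^ q + edist (mean f Q) (mean f S) ^ q +
            edist (f y) (mean f S) ^ q) := by
      intro y hy
      have h1 := h.whitney.centerDist_le_dist hQ S.2 hx hy.1 hy.2
      have hxy : 0 < dist x y := by
        by_contra hcon
        have : dist x y = 0 := le_antisymm (not_lt.1 hcon) dist_nonneg
        rw [this, mul_zero] at h1
        linarith
      have h2 : (edist x y ^ (s * q + d))⁻¹ ≤
          ENNReal.ofReal ((4 * (1 + d) : ℝ) ^ (s * q + d)) *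
            ENNReal.ofReal (Q.centerDist S ^ (-(d + s * q))) := by
        rw [edist_dist, ENNReal.ofReal_rpow_of_pos hxy,
          ← ENNReal.ofReal_inv_of_pos (by positivity), ← ENNReal.ofReal_mul (by positivity)]
        refine ENNReal.ofReal_le_ofReal ?_
        have h3 : Q.centerDist S ^ (s * q + d) ≤
            (4 * (1 + d) : ℝ) ^ (s * q + d) * dist x y ^ (s * q + d) := by
          rw [← Real.mul_rpow (by positivity) hxy.le]
          exact Real.rpow_le_rpow hD.le h1 hexp.le
        rw [Real.rpow_neg hD.le, add_comm (d : ℝ), ← div_eq_mul_inv, inv_eq_one_div,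
          div_le_div_iff₀ (by positivity) (by positivity), one_mul]
        exact h3
      have h4 : ‖f x - f y‖ₑ ^ q ≤ 4 ^ (q - 1) * (edist (f x) (mean f Q) ^ q +
          edist (mean f Q) (mean f S) ^ q + edist (f y) (mean f S) ^ q) := by
        refine le_trans ?_ (ENNReal.add_three_rpow_le hq _ _ _)
        rw [← edist_eq_enorm_sub, edist_comm (f y)]
        gcongr
        exact edist_triangle4 _ _ _ _
      rw [div_eq_mul_inv]
      refine (mul_le_mul' h4 h2).trans (le_of_eq ?_)
      rw [hB, ENNReal.coe_mul, ENNReal.coe_rpow_of_nonneg _ (by linarith)]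
      change _ = ENNReal.ofReal _ * _ * _ * _
      push_cast
      ring
    have h5 : ∫⁻ y in S.1.toSet, edist (f y) (mean f S) ^ q ≤
        ENNReal.ofReal (S.1.side ^ (d : ℝ)) *
          (C₄ * ENNReal.ofReal (S.1.side ^ (s * q)) * localMean s p q Ω f S) := by
      rw [setLIntegral_eq_volume_mul, volume_toSet]
      gcongr
      exact hC₄ Ω f S S hf (hfi S S.2) (hself S S.2) (by linarith)
    have h6 : S.1.side ^ (d : ℝ) * Q.centerDist S ^ (-(d + s * q)) * S.1.side ^ (s * q)
        ≤ kernel s Q S := by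
      rw [mul_right_comm, ← Real.rpow_add hS0, Real.rpow_neg hD.le, ← div_eq_mul_inv,
        ← Real.div_rpow hS0.le hD.le, kernel]
      refine Real.rpow_le_rpow_of_exponent_ge (by positivity) ?_ ?_
      · rw [div_le_one hD]; exact side_le_centerDist' _ _
      · nlinarith
    have hmeas : Measurable fun y => edist (f y) (mean f S) ^ q := by
      simp_rw [edist_eq_enorm_sub]; fun_prop
    calc _ ≤ ∫⁻ y in S.1.toSet \ Q.dilate 5,
          B * ENNReal.ofReal (Q.centerDist S ^ (-(d + s * q))) *
          (edist (f x) (mean f Q) ^ q + edist (mean f Q) (mean f S) ^ q +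
            edist (f y) (mean f S) ^ q) :=
          setLIntegral_mono' (S.1.measurableSet_toSet.diff (Q.isOpen_dilate 5).measurableSet) hpt
      _ ≤ ∫⁻ y in S.1.toSet,
          B * ENNReal.ofReal (Q.centerDist S ^ (-(d + s * q))) *
          (edist (f x) (mean f Q) ^ q + edist (mean f Q) (mean f S) ^ q +
            edist (f y) (mean f S) ^ q) := lintegral_mono_set Set.sdiff_subset
      _ = B * ENNReal.ofReal (Q.centerDist S ^ (-(d + s * q))) *
          ((edist (f x) (mean f Q) ^ q + edist (mean f Q) (mean f S) ^ q) *
            ENNReal.ofReal (S.1.side ^ (d : ℝ)) +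
            ∫⁻ y in S.1.toSet, edist (f y) (mean f S) ^ q) := by
          rw [lintegral_const_mul _ (hmeas.const_add _), lintegral_add_left
            measurable_const, setLIntegral_const, volume_toSet]
      _ ≤ B * ENNReal.ofReal (Q.centerDist S ^ (-(d + s * q))) *
          ((edist (f x) (mean f Q) ^ q + edist (mean f Q) (mean f S) ^ q) *
            ENNReal.ofReal (S.1.side ^ (d : ℝ)) + ENNReal.ofReal (S.1.side ^ (d : ℝ)) *
          (C₄ * ENNReal.ofReal (S.1.side ^ (s * q)) * localMean s p q Ω f S)) := by gcongr
      _ = B * (ENNReal.ofReal (S.1.side ^ (d : ℝ) * Q.centerDist S ^ (-(d + s * q))) *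
          edist (f x) (mean f Q) ^ q +
        ENNReal.ofReal (S.1.side ^ (d : ℝ) * Q.centerDist S ^ (-(d + s * q))) *
          edist (mean f Q) (mean f S) ^ q +
        C₄ * (ENNReal.ofReal (S.1.side ^ (d : ℝ) * Q.centerDist S ^ (-(d + s * q)) *
          S.1.side ^ (s * q)) * localMean s p q Ω f S)) := by
          rw [ENNReal.ofReal_mul (p := S.1.side ^ (d : ℝ) * _) (by positivity),
            ENNReal.ofReal_mul (by positivity)]
          ring
      _ ≤ _ := by gcongr
  have h7 : (∑' S : W, ENNReal.ofReal (S.1.side ^ (d : ℝ) * Q.centerDist S ^ (-(d + s * q))))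
      ≤ C₂ * ENNReal.ofReal (Q.side ^ (-(s * q))) := by
    refine le_trans (ENNReal.tsum_le_tsum fun S => ?_) (hC₂ W h.whitney.disjoint Q _ hQ0)
    rw [if_pos (side_le_centerDist _ _)]
  have h8 : (∑' S : W, ENNReal.ofReal (S.1.side ^ (d : ℝ) * Q.centerDist S ^ (-(d + s * q))) *
      edist (f x) (mean f Q) ^ q) ≤ C₁ * C₂ * A := by
    rw [ENNReal.tsum_mul_right]
    calc _ ≤ C₂ * ENNReal.ofReal (Q.side ^ (-(s * q))) *
          (C₁ * ENNReal.ofReal (Q.side ^ (s * q)) * A) :=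
          mul_le_mul' h7 (hC₁ Ω f Q Q (hfi Q hQ) (hself Q hQ) (by linarith) x hx)
      _ = C₁ * C₂ * A * (ENNReal.ofReal (Q.side ^ (-(s * q))) *
          ENNReal.ofReal (Q.side ^ (s * q))) := by ring
      _ = _ := by
          rw [← ENNReal.ofReal_mul (by positivity), ← Real.rpow_add hQ0, neg_add_cancel,
            Real.rpow_zero, ENNReal.ofReal_one, mul_one]
  calc _ ≤ _ := h.whitney.lintegral_le_tsum (Q.dilate 5) _
    _ ≤ _ := ENNReal.tsum_le_tsum hS
    _ ≤ B * (C₁ * C₂ * A + C₃ * T + C₄ * T) := by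
        rw [ENNReal.tsum_mul_left, ENNReal.tsum_add, ENNReal.tsum_add,
          ENNReal.tsum_mul_left (a := (C₄ : ℝ≥0∞))]
        gcongr
        exact hC₃ Ω W h f hf hfi Q hQ
    _ ≤ B * ((C₁ * C₂ + (C₃ + C₄)) * A + (C₁ * C₂ + (C₃ + C₄)) * T) := by
        rw [add_assoc, ← add_mul]
        exact mul_le_mul' le_rfl (add_le_add (mul_le_mul' le_self_add le_rfl)
          (mul_le_mul' le_add_self le_rfl))
    _ = _ := by push_cast; ring

theorem exists_diffIntegral_le (d : ℕ) {s p q ε : ℝ} (hs : 0 < s) (hq : 1 ≤ q)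
    (hqp : q ≤ p) (hε : 0 < ε) :
    ∃ C : ℝ≥0, ∀ (Ω : Set (EuclideanSpace ℝ (Fin d))) (W : Set (DyadicCube d)),
      IsUniformDomainWith ε W Ω → ∀ f : EuclideanSpace ℝ (Fin d) → ℂ, Measurable f →
      (∀ Q ∈ W, IntegrableOn f Q.toSet) → ∀ Q ∈ W, ∀ x ∈ Q.toSet,
      diffIntegral s q Ω f x ≤ C * (diffIntegral s q (Q.dilate 5 ∩ Ω) f x +
          ∑' P : W, ENNReal.ofReal (kernel s Q P) * localMean s p q Ω f P) := by
  obtain ⟨C, hC⟩ := exists_setLIntegral_diff_le d hs hq hqp hε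
  refine ⟨1 + C, fun Ω W h f hf hfi Q hQ x hx => ?_⟩
  have h1 : diffIntegral s q Ω f x = diffIntegral s q (Q.dilate 5 ∩ Ω) f x +
      ∫⁻ y in Ω \ Q.dilate 5, ‖f x - f y‖ₑ ^ q / edist x y ^ (s * q + d) := by
    unfold diffIntegral
    rw [Set.inter_comm, lintegral_inter_add_sdiff _ _ (Q.isOpen_dilate 5).measurableSet]
  rw [h1, ENNReal.coe_add, ENNReal.coe_one, add_mul, one_mul]
  exact add_le_add le_self_add (hC Ω W h f hf hfi Q hQ x hx)

theorem exists_lintegral_diffIntegral_le (d : ℕ) {s p q ε : ℝ} (hs : 0 < s) (hq : 1 ≤ q)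
    (hqp : q ≤ p) (hε : 0 < ε) :
    ∃ C : ℝ≥0, ∀ (Ω : Set (EuclideanSpace ℝ (Fin d))) (W : Set (DyadicCube d)),
      IsUniformDomainWith ε W Ω → ∀ f : EuclideanSpace ℝ (Fin d) → ℂ, Measurable f →
      (∀ Q ∈ W, IntegrableOn f Q.toSet) →
      ∫⁻ x in Ω, diffIntegral s q Ω f x ^ (p / q) ≤ C * ∑' Q : W, ∫⁻ x in Q.1.toSet,
        diffIntegral s q (Q.1.dilate 5 ∩ Ω) f x ^ (p / q) := by
  have hr : 1 ≤ p / q := by rw [le_div_iff₀ (by linarith)]; linarith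
  obtain ⟨C₁, hC₁⟩ := exists_diffIntegral_le d hs hq hqp hε
  obtain ⟨C₂, hC₂⟩ := exists_tsum_kernel_rpow_le d hs hε hr
  set r := p / q with hrdef
  refine ⟨C₁ ^ r * 2 ^ (r - 1) * (1 + C₂), fun Ω W h f hf hfi => ?_⟩
  have hQ : ∀ Q : W, ∫⁻ x in Q.1.toSet, diffIntegral s q Ω f x ^ r ≤
      ((C₁ ^ r * 2 ^ (r - 1) : ℝ≥0) : ℝ≥0∞) *
      ((∫⁻ x in Q.1.toSet, diffIntegral s q (Q.1.dilate 5 ∩ Ω) f x ^ r) +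
      ENNReal.ofReal (Q.1.side ^ (d : ℝ)) *
        (∑' P : W, ENNReal.ofReal (kernel s Q.1 P) * localMean s p q Ω f P) ^ r) := by
    intro Q
    set T := ∑' P : W, ENNReal.ofReal (kernel s Q.1 P) * localMean s p q Ω f P
    calc ∫⁻ x in Q.1.toSet, diffIntegral s q Ω f x ^ r
        ≤ ∫⁻ x in Q.1.toSet, ((C₁ ^ r * 2 ^ (r - 1) : ℝ≥0) : ℝ≥0∞) *
          (diffIntegral s q (Q.1.dilate 5 ∩ Ω) f x ^ r + T ^ r) := by
          refine setLIntegral_mono' Q.1.measurableSet_toSet fun x hx => ?_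
          calc diffIntegral s q Ω f x ^ r
              ≤ (C₁ * (diffIntegral s q (Q.1.dilate 5 ∩ Ω) f x + T)) ^ r := by
                gcongr; exact hC₁ Ω W h f hf hfi Q Q.2 x hx
            _ = C₁ ^ r * (diffIntegral s q (Q.1.dilate 5 ∩ Ω) f x + T) ^ r :=
                ENNReal.mul_rpow_of_nonneg _ _ (by linarith)
            _ ≤ C₁ ^ r * (2 ^ (r - 1) * (diffIntegral s q (Q.1.dilate 5 ∩ Ω) f x ^ r + T ^ r)) := by
                gcongr
                exact ENNReal.rpow_add_le_mul_rpow_add_rpow _ _ hr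
            _ = _ := by
                rw [ENNReal.coe_mul, ENNReal.coe_rpow_of_nonneg _ (by linarith),
                  ENNReal.coe_rpow_of_nonneg _ (by linarith), mul_assoc]
                rfl
      _ = _ := by
          have hm := (measurable_diffIntegral s q (Q.1.dilate 5 ∩ Ω) hf).pow_const r
          rw [lintegral_const_mul _ (hm.add_const _), lintegral_add_left hm, setLIntegral_const,
            volume_toSet, mul_comm (T ^ r)]
  calc ∫⁻ x in Ω, diffIntegral s q Ω f x ^ r
      ≤ ∑' Q : W, ∫⁻ x in Q.1.toSet, diffIntegral s q Ω f x ^ r := by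
        simpa using h.whitney.lintegral_le_tsum ∅ fun x => diffIntegral s q Ω f x ^ r
    _ ≤ _ := ENNReal.tsum_le_tsum hQ
    _ ≤ ((C₁ ^ r * 2 ^ (r - 1) : ℝ≥0) : ℝ≥0∞) *
        ((∑' Q : W, ∫⁻ x in Q.1.toSet, diffIntegral s q (Q.1.dilate 5 ∩ Ω) f x ^ r) +
          C₂ * ∑' Q : W, ∫⁻ x in Q.1.toSet, diffIntegral s q (Q.1.dilate 5 ∩ Ω) f x ^ r) := by
        rw [ENNReal.tsum_mul_left, ENNReal.tsum_add]
        gcongr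
        refine (hC₂ Ω W h fun P => localMean s p q Ω f P).trans (le_of_eq ?_)
        congr 2; ext Q
        exact (setLIntegral_eq_localMean hq hqp Ω f Q.1).symm
    _ = _ := by
        rw [ENNReal.coe_mul (C₁ ^ r * 2 ^ (r - 1)), ENNReal.coe_add, ENNReal.coe_one, mul_assoc]
        ring

end IsUniformDomainWith

theorem whitneyASeminorm_le_dotASeminorm {d : ℕ} {s p q : ℝ} (hp : 0 < p)
    {W : Set (DyadicCube d)} {Ω : Set (EuclideanSpace ℝ (Fin d))} (hW : IsWhitneyCovering W Ω)
    (hq : 0 < q) (f : EuclideanSpace ℝ (Fin d) → ℂ) :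
    whitneyASeminorm s p q W Ω f ≤ dotASeminorm s p q Ω f := by
  unfold whitneyASeminorm dotASeminorm
  gcongr
  calc _ ≤ ∑' Q : W, ∫⁻ x in Q.1.toSet, diffIntegral s q Ω f x ^ (p / q) := by
        gcongr with Q x
        exact lintegral_mono_set Set.inter_subset_right
    _ = ∫⁻ x in ⋃ Q : W, Q.1.toSet, diffIntegral s q Ω f x ^ (p / q) :=
        (lintegral_iUnion (fun P : W => P.1.measurableSet_toSet)
          (fun P P' hne => hW.disjoint P.2 P'.2 fun h => hne (Subtype.ext h)) _).symm
    _ ≤ _ := lintegral_mono_set (Set.iUnion_subset fun Q => hW.toSet_subset Q.2)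

theorem dotASeminorm_congr {d : ℕ} {s p q : ℝ} {Ω : Set (EuclideanSpace ℝ (Fin d))}
    {f g : EuclideanSpace ℝ (Fin d) → ℂ} (hfg : f =ᵐ[volume.restrict Ω] g) :
    dotASeminorm s p q Ω f = dotASeminorm s p q Ω g := by
  unfold dotASeminorm
  congr 1
  refine lintegral_congr_ae ?_
  filter_upwards [hfg] with x hx
  rw [diffIntegral_congr hfg subset_rfl hx]

theorem whitneyASeminorm_congr {d : ℕ} {s p q : ℝ} {W : Set (DyadicCube d)}
    {Ω : Set (EuclideanSpace ℝ (Fin d))} (hW : IsWhitneyCovering W Ω)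
    {f g : EuclideanSpace ℝ (Fin d) → ℂ} (hfg : f =ᵐ[volume.restrict Ω] g) :
    whitneyASeminorm s p q W Ω f = whitneyASeminorm s p q W Ω g := by
  unfold whitneyASeminorm
  congr 2; ext Q
  refine lintegral_congr_ae ?_
  filter_upwards [ae_restrict_of_ae_restrict_of_subset (hW.toSet_subset Q.2) hfg] with x hx
  rw [diffIntegral_congr hfg Set.inter_subset_right hx]

theorem theoremA3 (d : ℕ) (hd : 1 ≤ d) (s p q ε : ℝ) (hs0 : 0 < s) (hs1 : s < 1)
    (hq : 1 ≤ q) (hqp : q ≤ p) :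
    ∃ C : ℝ≥0, ∀ (Ω : Set (EuclideanSpace ℝ (Fin d))) (W : Set (DyadicCube d)),
      IsUniformDomainWith ε W Ω →
      ∀ f : EuclideanSpace ℝ (Fin d) → ℂ, LocallyIntegrableOn f Ω volume →
        whitneyASeminorm s p q W Ω f ≤ C * dotASeminorm s p q Ω f ∧
        dotASeminorm s p q Ω f ≤ C * whitneyASeminorm s p q W Ω f := by
  rcases le_or_gt ε 0 with hε | hε
  · exact ⟨0, fun Ω W h => absurd h.eps_pos (not_lt.2 hε)⟩
  have hp : 0 < p := by linarith
  obtain ⟨C, hC⟩ := IsUniformDomainWith.exists_lintegral_diffIntegral_le d hs0 hq hqp hε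
  refine ⟨1 + C ^ (1 / p), fun Ω W h f hf => ⟨?_, ?_⟩⟩
  · refine (whitneyASeminorm_le_dotASeminorm hp h.whitney (by linarith) f).trans
      (le_mul_of_one_le_left' ?_)
    rw [ENNReal.coe_add, ENNReal.coe_one]
    exact le_self_add
  · -- replace `f` by a measurable representative
    have hmeas := hf.aestronglyMeasurable
    set g := hmeas.mk f with hg
    have hfg : f =ᵐ[volume.restrict Ω] g := hmeas.ae_eq_mk
    rw [dotASeminorm_congr hfg, whitneyASeminorm_congr h.whitney hfg]
    have hgi : ∀ Q ∈ W, IntegrableOn g Q.toSet := by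
      intro Q hQ
      have h1 : IntegrableOn f Q.toSet :=
        (hf.integrableOn_compact_subset (h.whitney.closure_subset hQ)
          Q.isCompact_closure_toSet).mono_set subset_closure
      exact h1.congr (ae_restrict_of_ae_restrict_of_subset (h.whitney.toSet_subset hQ) hfg)
    have h2 := hC Ω W h g hmeas.stronglyMeasurable_mk.measurable hgi
    calc dotASeminorm s p q Ω g ≤ (C * ∑' Q : W, ∫⁻ x in Q.1.toSet,
          diffIntegral s q (Q.1.dilate 5 ∩ Ω) g x ^ (p / q)) ^ (1 / p) := by
          unfold dotASeminorm; gcongr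
      _ = (C ^ (1 / p) : ℝ≥0) * whitneyASeminorm s p q W Ω g := by
          rw [ENNReal.mul_rpow_of_nonneg _ _ (by positivity),
            ENNReal.coe_rpow_of_nonneg _ (by positivity)]
          rfl
      _ ≤ _ := by
          gcongr
          exact le_add_self
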